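/- Let $N\ge 2$, let $T=\{x\in\mathbb{R}^N : 1<|x|<2\}$, and let $2<p<2^*$, where $2^*=\frac{2N}{N-2}$ if $N\ge 3$ and $2^*=+\infty$ if $N=2$. For every sufficiently large $\lambda$ let $u_\lambda$ be a (it is known: the unique) positive radially symmetric weak solution in $H^1_0(T)$ of $$-\Delta u+\lambda u=|u|^{p-2}u\ \text{ in } T,\qquad u=0\ \text{ on }\partial T .$$ Then, as $\lambda\to+\infty$: 1. if $N\ge 3$, or if $N=2$ and $p<6$, then $\int_T u_\lambda^2\,dx\to+\infty$; 2. if $N=2$ and $p=6$, then $0<\liminf_{\lambda\to+\infty}\int_T u_\lambda^2\,dx<+\infty$; 3. if $N=2$ and $p>6$, then $\int_T u_\lambda^2\,dx\to 0$. -/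

import Mathlib

open MeasureTheory Filter Topology
open scoped ContDiff

/-- The open annulus `{x ∈ ℝᴺ : 1 < |x| < 2}`, with the Euclidean norm. -/
def annulus (N : ℕ) : Set (EuclideanSpace ℝ (Fin N)) := {x | 1 < ‖x‖ ∧ ‖x‖ < 2}

/-- `φ ∈ C_c^∞(Ω)`: a smooth function whose (compact) support lies in `Ω`. -/
structure IsTestFunction {N : ℕ} (Ω : Set (EuclideanSpace ℝ (Fin N)))
    (φ : EuclideanSpace ℝ (Fin N) → ℝ) : Prop where
  contDiff : ContDiff ℝ ∞ φ
  hasCompactSupport : HasCompactSupport φ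
  tsupport_subset : tsupport φ ⊆ Ω

/-- `u ∈ H¹(Ω)` with weak gradient `g`: both are in `L²(Ω)`, and `∫ u ∂ᵥφ = - ∫ (g · v) φ`
for every direction `v` and every test function `φ`. -/
structure IsH1 {N : ℕ} (Ω : Set (EuclideanSpace ℝ (Fin N)))
    (u : EuclideanSpace ℝ (Fin N) → ℝ)
    (g : EuclideanSpace ℝ (Fin N) → EuclideanSpace ℝ (Fin N)) : Prop where
  memLp : MemLp u 2 (volume.restrict Ω)
  memLp_grad : MemLp g 2 (volume.restrict Ω)
  weak_grad : ∀ φ : EuclideanSpace ℝ (Fin N) → ℝ, IsTestFunction Ω φ →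
    ∀ v : EuclideanSpace ℝ (Fin N),
      ∫ x in Ω, u x * fderiv ℝ φ x v = -∫ x in Ω, inner ℝ (g x) v * φ x

/-- `u ∈ H¹₀(Ω)` with weak gradient `g`: `u` is in the closure of `C_c^∞(Ω)` in `H¹(Ω)`. -/
structure IsH10 {N : ℕ} (Ω : Set (EuclideanSpace ℝ (Fin N)))
    (u : EuclideanSpace ℝ (Fin N) → ℝ)
    (g : EuclideanSpace ℝ (Fin N) → EuclideanSpace ℝ (Fin N)) : Prop where
  isH1 : IsH1 Ω u g
  approx : ∃ φ : ℕ → EuclideanSpace ℝ (Fin N) → ℝ, (∀ n, IsTestFunction Ω (φ n)) ∧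
    Tendsto (fun n => eLpNorm (fun x => φ n x - u x) 2 (volume.restrict Ω)) atTop (𝓝 0) ∧
    Tendsto (fun n => eLpNorm (fun x => gradient (φ n) x - g x) 2 (volume.restrict Ω))
      atTop (𝓝 0)

/-- `u` is a positive weak solution in `H¹₀,rad(T)` of `-Δu + l u = |u|^(p-2) u` in the
annulus `T`, `u = 0` on `∂T`. Being an element of a Sobolev space, `u` is only considered
up to equality almost everywhere, also in the radial symmetry and the positivity. -/
structure IsPositiveRadialSolution (N : ℕ) (p l : ℝ)
    (u : EuclideanSpace ℝ (Fin N) → ℝ) : Prop where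
  radial : ∃ f : ℝ → ℝ, ∀ᵐ x ∂(volume.restrict (annulus N)), u x = f ‖x‖
  pos : ∀ᵐ x ∂(volume.restrict (annulus N)), 0 < u x
  weak_solution : ∃ g : EuclideanSpace ℝ (Fin N) → EuclideanSpace ℝ (Fin N),
    IsH10 (annulus N) u g ∧
    ∀ φ : EuclideanSpace ℝ (Fin N) → ℝ, IsTestFunction (annulus N) φ →
      (∫ x in annulus N, inner ℝ (g x) (gradient φ x)) + l * ∫ x in annulus N, u x * φ x
        = ∫ x in annulus N, |u x| ^ (p - 2) * u x * φ x

/-! A radial solution is a function `w` of one variable, so its mass is the area of the unit sphere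
times `∫ r ^ n * w ^ 2` with `n = N - 1`. The asymptotics follow from two explicit inequalities for
profiles, with no blow-up analysis and no limit profile.

Lower bound (any dimension, `2 < p ≤ 6`). Let `M` be the maximum of `w`, `m` the weighted mass and
`E` the Dirichlet energy. Testing the equation with `w` gives `E + l m ≤ M ^ (p - 2) * m`, hence
both `l ≤ M ^ (p - 2)` and `E ≤ M ^ (p - 2) * m`. The one-dimensional inequality `M ^ 2 ≤ ε m + E /
ε` with `ε = M ^ ((p - 2) / 2)` then yields `m ≥ M ^ ((6 - p) / 2) / 2`, which is bounded below by a
power of `l` (`rpow_le_integral`). For `N ≥ 3` subcriticality forces `p < 6`.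

Upper bound (`N = 2`, `p ≥ 6`). The energy `w' ^ 2 / 2 - l w ^ 2 / 2 + w ^ p / p` decreases and is
nonnegative at `r = 2`, hence everywhere. So `w` is positive inside and has exactly one critical
point. Fix `θ` with `θ ^ (p - 2) = l p / 4`. Where `w ≤ θ`, nonnegative energy gives `|w'| ≥ √(l /
2) * w`, that is, exponential decay. Where `w ≥ θ`, monotonicity of `y ^ 2 + 2 / (3 p) * w ^ p` on
each side of the peak gives `w' ^ 2 ≥ k ^ 2 * (M - w)`, so this region is short. Each contribution
to the mass is at most of order `θ ^ (3 - p / 2)`: bounded for `p = 6`, vanishing for `p > 6`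
(`integral_sq_le`).

Reduction to profiles. In polar coordinates the spherical means of the approximating test functions
are primitives vanishing at both ends; this passes to the `L¹` limit. Radial test functions then
give a one-dimensional weak equation, and du Bois-Reymond makes it classical
(`exists_isRadialProfile`). -/

/-- The classical radial form of `-Δw + l w = |w|^(p-2) w` on `1 < r < 2` in dimension `n + 1`,
as a first order system for `w` and the flux `y = r ^ n * w'`, with Dirichlet conditions. -/
structure IsRadialProfile (n : ℕ) (p l : ℝ) (w y : ℝ → ℝ) : Prop where
  continuousOn : ContinuousOn w (Set.Icc 1 2)
  continuousOn_flux : ContinuousOn y (Set.Icc 1 2)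
  hasDerivAt : ∀ r ∈ Set.Ioo (1 : ℝ) 2, HasDerivAt w (y r / r ^ n) r
  hasDerivAt_flux : ∀ r ∈ Set.Ioo (1 : ℝ) 2,
    HasDerivAt y (r ^ n * (l * w r - |w r| ^ (p - 2) * w r)) r
  left_eq_zero : w 1 = 0
  right_eq_zero : w 2 = 0
  ae_pos : ∀ᵐ r ∂(volume.restrict (Set.Ioo (1 : ℝ) 2)), 0 < w r

/-! ### Lower bound for the mass of a profile, in any dimension. -/

namespace IsRadialProfile

variable {n : ℕ} {p l : ℝ} {w y : ℝ → ℝ}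

/-- A set of full measure is dense. This is how almost everywhere positivity is used against
continuity. -/
lemma exists_pos_of_isOpen (h : IsRadialProfile n p l w y) {U : Set ℝ} (hU : IsOpen U)
    (hne : U.Nonempty) (hsub : U ⊆ Set.Ioo 1 2) : ∃ r ∈ U, 0 < w r := by
  have hd : Dense {r : ℝ | r ∈ Set.Ioo (1 : ℝ) 2 → 0 < w r} :=
    Measure.dense_of_ae ((ae_restrict_iff' measurableSet_Ioo).1 h.ae_pos)
  obtain ⟨r, hrU, hr⟩ := hd.inter_open_nonempty U hU hne
  exact ⟨r, hrU, hr (hsub hrU)⟩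

lemma nonneg (h : IsRadialProfile n p l w y) {r : ℝ} (hr : r ∈ Set.Icc (1 : ℝ) 2) :
    0 ≤ w r := by
  rcases eq_or_lt_of_le hr.1 with h1 | h1
  · rw [← h1, h.left_eq_zero]
  rcases eq_or_lt_of_le hr.2 with h2 | h2
  · rw [h2, h.right_eq_zero]
  by_contra! hneg
  have hc : ContinuousAt w r := h.continuousOn.continuousAt (Icc_mem_nhds h1 h2)
  have hev : ∀ᶠ x in 𝓝 r, w x < 0 ∧ x ∈ Set.Ioo (1 : ℝ) 2 :=
    (hc.eventually_lt continuousAt_const hneg).and (Ioo_mem_nhds h1 h2)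
  obtain ⟨U, hU, hUo, hrU⟩ := eventually_nhds_iff.1 hev
  obtain ⟨x, hxU, hx⟩ := h.exists_pos_of_isOpen hUo ⟨r, hrU⟩ fun x hx => (hU x hx).2
  exact absurd (hU x hxU).1 hx.not_gt

lemma exists_max (h : IsRadialProfile n p l w y) :
    ∃ s ∈ Set.Ioo (1 : ℝ) 2, 0 < w s ∧ ∀ r ∈ Set.Icc (1 : ℝ) 2, w r ≤ w s := by
  obtain ⟨s, hs, hmax⟩ := isCompact_Icc.exists_isMaxOn (Set.nonempty_Icc.2 (by norm_num))
    h.continuousOn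
  obtain ⟨r, hr, hpos⟩ := h.exists_pos_of_isOpen isOpen_Ioo
    (Set.nonempty_Ioo.2 (by norm_num)) subset_rfl
  have hws : 0 < w s := hpos.trans_le (hmax (Set.Ioo_subset_Icc_self hr))
  refine ⟨s, ⟨lt_of_le_of_ne hs.1 ?_, lt_of_le_of_ne hs.2 ?_⟩, hws, fun r hr => hmax hr⟩
  · rintro rfl; exact hws.ne' h.left_eq_zero
  · rintro rfl; exact hws.ne' h.right_eq_zero

lemma pow_pos_of_mem {r : ℝ} (hr : r ∈ Set.Icc (1 : ℝ) 2) : 0 < r ^ n :=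
  pow_pos (by linarith [hr.1]) n

lemma continuousOn_pow_mul_sq (h : IsRadialProfile n p l w y) :
    ContinuousOn (fun r => r ^ n * w r ^ 2) (Set.Icc 1 2) :=
  (continuousOn_pow n).mul (h.continuousOn.pow 2)

lemma continuousOn_energy_density (h : IsRadialProfile n p l w y) :
    ContinuousOn (fun r => y r ^ 2 / r ^ n) (Set.Icc 1 2) :=
  (h.continuousOn_flux.pow 2).div (continuousOn_pow n) fun _ hr => (pow_pos_of_mem hr).ne'

/-- Testing the equation with `w` itself. -/
lemma energy_identity (h : IsRadialProfile n p l w y) (hp : 2 < p) :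
    (∫ r in (1 : ℝ)..2, y r ^ 2 / r ^ n) + l * ∫ r in (1 : ℝ)..2, r ^ n * w r ^ 2
      = ∫ r in (1 : ℝ)..2, |w r| ^ (p - 2) * (r ^ n * w r ^ 2) := by
  have c1 := h.continuousOn_energy_density
  have c2 := h.continuousOn_pow_mul_sq
  have c3 : ContinuousOn (fun r => |w r| ^ (p - 2) * (r ^ n * w r ^ 2)) (Set.Icc 1 2) :=
    (h.continuousOn.abs.rpow_const fun _ _ => Or.inr (by linarith)).mul c2
  have i1 := c1.intervalIntegrable_of_Icc (μ := volume) (by norm_num : (1 : ℝ) ≤ 2)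
  have i2 := (c2.intervalIntegrable_of_Icc (μ := volume) (by norm_num : (1 : ℝ) ≤ 2)).const_mul l
  have i3 := c3.intervalIntegrable_of_Icc (μ := volume) (by norm_num : (1 : ℝ) ≤ 2)
  have key := intervalIntegral.integral_eq_sub_of_hasDerivAt_of_le (a := 1) (b := 2)
    (f := fun r => w r * y r)
    (f' := fun r => y r ^ 2 / r ^ n + l * (r ^ n * w r ^ 2)
      - |w r| ^ (p - 2) * (r ^ n * w r ^ 2))
    (by norm_num) (h.continuousOn.mul h.continuousOn_flux)
    (fun r hr => by
      refine ((h.hasDerivAt r hr).mul (h.hasDerivAt_flux r hr)).congr_deriv ?_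
      ring) ((i1.add i2).sub i3)
  rw [intervalIntegral.integral_sub (i1.add i2) i3, intervalIntegral.integral_add i1 i2,
    intervalIntegral.integral_const_mul] at key
  simp only [h.left_eq_zero, h.right_eq_zero, zero_mul, sub_zero] at key
  linarith

lemma integral_pow_mul_sq_pos (h : IsRadialProfile n p l w y) :
    0 < ∫ r in (1 : ℝ)..2, r ^ n * w r ^ 2 := by
  obtain ⟨s, hs, hpos, -⟩ := h.exists_max
  refine intervalIntegral.integral_pos (by norm_num) h.continuousOn_pow_mul_sq
    (fun r hr => ?_) ⟨s, Set.Ioo_subset_Icc_self hs, ?_⟩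
  · have := pow_pos_of_mem (n := n) (Set.Ioc_subset_Icc_self hr)
    positivity
  · have := pow_pos_of_mem (n := n) (Set.Ioo_subset_Icc_self hs)
    positivity

/-- Any bound `M` for a profile satisfies `l ≤ M ^ (p - 2)`, and bounds the Dirichlet energy
by the mass. -/
lemma energy_le (h : IsRadialProfile n p l w y) (hp : 2 < p) {M : ℝ}
    (hM : ∀ r ∈ Set.Icc (1 : ℝ) 2, w r ≤ M) :
    (∫ r in (1 : ℝ)..2, y r ^ 2 / r ^ n) + l * (∫ r in (1 : ℝ)..2, r ^ n * w r ^ 2)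
      ≤ M ^ (p - 2) * ∫ r in (1 : ℝ)..2, r ^ n * w r ^ 2 := by
  rw [h.energy_identity hp, ← intervalIntegral.integral_const_mul]
  have c2 := h.continuousOn_pow_mul_sq
  have c3 : ContinuousOn (fun r => |w r| ^ (p - 2) * (r ^ n * w r ^ 2)) (Set.Icc 1 2) :=
    (h.continuousOn.abs.rpow_const fun _ _ => Or.inr (by linarith)).mul c2
  refine intervalIntegral.integral_mono_on (by norm_num)
    (c3.intervalIntegrable_of_Icc (by norm_num))
    ((c2.intervalIntegrable_of_Icc (by norm_num)).const_mul _) fun r hr => ?_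
  have h0 := h.nonneg hr
  have := pow_pos_of_mem (n := n) hr
  rw [abs_of_nonneg h0]
  gcongr
  exact hM r hr

lemma energy_nonneg :
    0 ≤ ∫ r in (1 : ℝ)..2, y r ^ 2 / r ^ n :=
  intervalIntegral.integral_nonneg (by norm_num) fun r hr => by
    have := pow_pos_of_mem (n := n) hr
    positivity

lemma le_rpow_of_bound (h : IsRadialProfile n p l w y) (hp : 2 < p) {M : ℝ}
    (hM : ∀ r ∈ Set.Icc (1 : ℝ) 2, w r ≤ M) : l ≤ M ^ (p - 2) := by
  have h1 := h.energy_le hp hM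
  have h2 := h.integral_pow_mul_sq_pos
  have h3 : 0 ≤ ∫ r in (1 : ℝ)..2, y r ^ 2 / r ^ n := energy_nonneg
  exact le_of_mul_le_mul_right (by linarith) h2

/-- One-dimensional Gagliardo–Nirenberg inequality, in a form with a free parameter. -/
lemma sq_le_of_mem (h : IsRadialProfile n p l w y) {s : ℝ} (hs : s ∈ Set.Ioo (1 : ℝ) 2)
    {ε : ℝ} (hε : 0 < ε) :
    w s ^ 2 ≤ ε * (∫ r in (1 : ℝ)..2, r ^ n * w r ^ 2)
      + ε⁻¹ * ∫ r in (1 : ℝ)..2, y r ^ 2 / r ^ n := by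
  have hsub : Set.Icc 1 s ⊆ Set.Icc (1 : ℝ) 2 := Set.Icc_subset_Icc_right hs.2.le
  have c1 := h.continuousOn_energy_density
  have c2 := h.continuousOn_pow_mul_sq
  have c3 : ContinuousOn (fun r => 2 * w r * (y r / r ^ n)) (Set.Icc 1 2) :=
    (continuousOn_const.mul h.continuousOn).mul
      (h.continuousOn_flux.div (continuousOn_pow n) fun _ hr => (pow_pos_of_mem hr).ne')
  have c4 : ContinuousOn (fun r => ε * (r ^ n * w r ^ 2) + ε⁻¹ * (y r ^ 2 / r ^ n))
      (Set.Icc 1 2) := (continuousOn_const.mul c2).add (continuousOn_const.mul c1)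
  have key := intervalIntegral.integral_eq_sub_of_hasDerivAt_of_le (a := 1) (b := s)
    (f := fun r => w r ^ 2) (f' := fun r => 2 * w r * (y r / r ^ n))
    hs.1.le ((h.continuousOn.mono hsub).pow 2)
    (fun r hr => by
      refine ((h.hasDerivAt r ⟨hr.1, hr.2.trans hs.2⟩).pow 2).congr_deriv ?_
      norm_num)
    ((c3.mono hsub).intervalIntegrable_of_Icc hs.1.le)
  have hw1 := h.left_eq_zero
  simp only [hw1] at key
  have e1 : w s ^ 2 = ∫ r in (1 : ℝ)..s, 2 * w r * (y r / r ^ n) := by rw [key]; ring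
  have hpt : ∀ r ∈ Set.Icc (1 : ℝ) 2,
      2 * w r * (y r / r ^ n) ≤ ε * (r ^ n * w r ^ 2) + ε⁻¹ * (y r ^ 2 / r ^ n) := by
    intro r hr
    have hr1 : 1 ≤ r ^ n := one_le_pow₀ hr.1
    have hr0 : 0 < r ^ n := by linarith
    have h1 : 2 * w r * (y r / r ^ n) ≤ ε * w r ^ 2 / r ^ n + ε⁻¹ * (y r ^ 2 / r ^ n) := by
      have : ε * w r ^ 2 / r ^ n + ε⁻¹ * (y r ^ 2 / r ^ n) - 2 * w r * (y r / r ^ n)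
          = ε⁻¹ * (ε * w r - y r) ^ 2 / r ^ n := by
        field_simp; ring
      have : 0 ≤ ε⁻¹ * (ε * w r - y r) ^ 2 / r ^ n := by positivity
      linarith
    -- Since `r ≥ 1`, the weight `1 / r ^ n` left by completing the square is at most `r ^ n`.
    have h2 : ε * w r ^ 2 / r ^ n ≤ ε * (r ^ n * w r ^ 2) := by
      rw [div_le_iff₀ hr0]
      have : 0 ≤ ε * w r ^ 2 := by positivity
      have h3 : 1 ≤ r ^ n * r ^ n := by nlinarith
      calc ε * w r ^ 2 ≤ ε * w r ^ 2 * (r ^ n * r ^ n) := le_mul_of_one_le_right this h3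
        _ = _ := by ring
    linarith
  calc w s ^ 2 = ∫ r in (1 : ℝ)..s, 2 * w r * (y r / r ^ n) := e1
    _ ≤ ∫ r in (1 : ℝ)..s, (ε * (r ^ n * w r ^ 2) + ε⁻¹ * (y r ^ 2 / r ^ n)) :=
      intervalIntegral.integral_mono_on hs.1.le
        ((c3.mono hsub).intervalIntegrable_of_Icc hs.1.le)
        ((c4.mono hsub).intervalIntegrable_of_Icc hs.1.le) fun r hr => hpt r (hsub hr)
    _ ≤ ∫ r in (1 : ℝ)..2, (ε * (r ^ n * w r ^ 2) + ε⁻¹ * (y r ^ 2 / r ^ n)) := by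
      refine intervalIntegral.integral_mono_interval le_rfl hs.1.le hs.2.le ?_
        (c4.intervalIntegrable_of_Icc (by norm_num))
      filter_upwards [ae_restrict_mem measurableSet_Ioc] with r hr
      have := pow_pos_of_mem (n := n) (Set.Ioc_subset_Icc_self hr)
      simp only [Pi.zero_apply]
      positivity
    _ = _ := by
      rw [intervalIntegral.integral_add
        ((c2.intervalIntegrable_of_Icc (by norm_num)).const_mul _)
        ((c1.intervalIntegrable_of_Icc (by norm_num)).const_mul _),
        intervalIntegral.integral_const_mul, intervalIntegral.integral_const_mul]

/-- For `2 < p ≤ 6` the mass is at least of order `l ^ ((6 - p) / (2 (p - 2)))`. -/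
theorem rpow_le_integral (h : IsRadialProfile n p l w y) (hp : 2 < p) (hp6 : p ≤ 6)
    (hl : 0 < l) :
    l ^ ((6 - p) / (2 * (p - 2))) / 2 ≤ ∫ r in (1 : ℝ)..2, r ^ n * w r ^ 2 := by
  obtain ⟨s, hs, hM, hmax⟩ := h.exists_max
  set M := w s with hMdef
  set m := ∫ r in (1 : ℝ)..2, r ^ n * w r ^ 2 with hm
  have hm0 : 0 < m := h.integral_pow_mul_sq_pos
  have hlM := h.le_rpow_of_bound hp hmax
  have hE := h.energy_le hp hmax
  -- This parameter balances the two terms of the interpolation inequality, because `E ≤ M ^ (p - 2)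
  -- * m`.
  have hε : 0 < M ^ ((p - 2) / 2) := Real.rpow_pos_of_pos hM _
  have hGN := h.sq_le_of_mem hs hε
  rw [← hm, ← hMdef] at *
  have hsq : M ^ (p - 2) = M ^ ((p - 2) / 2) * M ^ ((p - 2) / 2) := by
    rw [← Real.rpow_add hM]; congr 1; ring
  have hE' : (∫ r in (1 : ℝ)..2, y r ^ 2 / r ^ n) ≤ M ^ (p - 2) * m := by
    have := mul_pos hl hm0
    linarith
  have h1 : M ^ 2 ≤ 2 * M ^ ((p - 2) / 2) * m := by
    have : (M ^ ((p - 2) / 2))⁻¹ * (∫ r in (1 : ℝ)..2, y r ^ 2 / r ^ n)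
        ≤ M ^ ((p - 2) / 2) * m := by
      rw [inv_mul_le_iff₀ hε, ← mul_assoc, ← hsq]; exact hE'
    linarith
  -- The exponent is nonnegative exactly because `p ≤ 6`, so `l ≤ M ^ (p - 2)` can be raised to it.
  have h2 : l ^ ((6 - p) / (2 * (p - 2))) ≤ M ^ ((6 - p) / 2) := by
    calc l ^ ((6 - p) / (2 * (p - 2))) ≤ (M ^ (p - 2)) ^ ((6 - p) / (2 * (p - 2))) :=
          Real.rpow_le_rpow hl.le hlM (div_nonneg (by linarith) (by linarith))
      _ = M ^ ((6 - p) / 2) := by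
          rw [← Real.rpow_mul hM.le]
          congr 1
          have : p - 2 ≠ 0 := by linarith
          field_simp
  have h3 : M ^ ((6 - p) / 2) * M ^ ((p - 2) / 2) = M ^ 2 := by
    rw [← Real.rpow_add hM, ← Real.rpow_natCast]; congr 1; push_cast; ring
  have h4 : M ^ ((6 - p) / 2) ≤ 2 * m := by
    refine le_of_mul_le_mul_right ?_ hε
    rw [h3]; linarith
  linarith

end IsRadialProfile

/-! ### Upper bound for the mass of planar profiles with `p ≥ 6`. -/

/-- A decreasing function from `M` to `0` which descends from `M` to `θ` at least as fast as a
parabola, and from `θ` to `0` at least exponentially fast, has a small `L²` norm. -/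
lemma integral_sq_le_of_descent {w w' : ℝ → ℝ} {a e M θ k q : ℝ} (hae : a < e)
    (hc : ContinuousOn w (Set.Icc a e)) (hc' : ContinuousOn w' (Set.Icc a e))
    (hd : ∀ r ∈ Set.Ioo a e, HasDerivAt w (w' r) r) (hneg : ∀ r ∈ Set.Ioo a e, w' r < 0)
    (ha : w a = M) (he : w e = 0) (hθ : 0 < θ) (hθM : θ < M) (hq : 0 < q) (hk : 0 < k)
    (hlow : ∀ r ∈ Set.Ioo a e, w r ≤ θ → q * w r ≤ -w' r)
    (hhigh : ∀ r ∈ Set.Ioo a e, θ ≤ w r → k ^ 2 * (M - w r) ≤ w' r ^ 2) :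
    ∫ r in a..e, w r ^ 2 ≤ M ^ 2 * (2 * √M / k) + θ ^ 2 / (2 * q) := by
  have hanti : StrictAntiOn w (Set.Icc a e) := by
    refine strictAntiOn_of_deriv_neg (convex_Icc a e) hc fun r hr => ?_
    rw [interior_Icc] at hr
    rw [(hd r hr).deriv]
    exact hneg r hr
  obtain ⟨b, hb, hwb⟩ : θ ∈ w '' Set.Icc a e :=
    intermediate_value_Icc' hae.le hc ⟨by rw [he]; exact hθ.le, by rw [ha]; exact hθM.le⟩
  have hab : a < b := lt_of_le_of_ne hb.1 (by rintro rfl; linarith)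
  have hbe : b < e := lt_of_le_of_ne hb.2 (by rintro rfl; linarith)
  have hs1 : Set.Icc a b ⊆ Set.Icc a e := Set.Icc_subset_Icc_right hbe.le
  have hs2 : Set.Icc b e ⊆ Set.Icc a e := Set.Icc_subset_Icc_left hab.le
  have hwpos : ∀ r ∈ Set.Icc a e, 0 ≤ w r := fun r hr =>
    he ▸ hanti.antitoneOn hr (Set.right_mem_Icc.2 hae.le) hr.2
  -- The function `√(M - w)` has slope at least `k / 2` while `w ≥ θ`, and it stays between `0` and
  -- `√M`.
  have hlen : b - a ≤ 2 * √M / k := by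
    have hmv : k / 2 * (b - a) ≤ √(M - w b) - √(M - w a) := by
      refine Convex.mul_sub_le_image_sub_of_le_deriv (f := fun r => √(M - w r)) (convex_Icc a b)
        ((continuousOn_const.sub (hc.mono hs1)).sqrt) ?_ ?_ a (Set.left_mem_Icc.2 hab.le) b
        (Set.right_mem_Icc.2 hab.le) hab.le
      all_goals rw [interior_Icc]
      · intro r hr
        have hr' : r ∈ Set.Ioo a e := ⟨hr.1, hr.2.trans hbe⟩
        have hlt : w r < M := ha ▸ hanti (Set.left_mem_Icc.2 hae.le)
          (Set.Ioo_subset_Icc_self hr') hr.1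
        exact (((hd r hr').const_sub M).sqrt (by linarith)).differentiableAt.differentiableWithinAt
      · intro r hr
        have hr' : r ∈ Set.Ioo a e := ⟨hr.1, hr.2.trans hbe⟩
        have hlt : w r < M := ha ▸ hanti (Set.left_mem_Icc.2 hae.le)
          (Set.Ioo_subset_Icc_self hr') hr.1
        have hge : θ ≤ w r := hwb ▸ hanti.antitoneOn (Set.Ioo_subset_Icc_self hr') hb hr.2.le
        rw [(((hd r hr').const_sub M).sqrt (by linarith)).deriv]
        have hsq : 0 < √(M - w r) := Real.sqrt_pos.2 (by linarith)
        have h1 := hhigh r hr' hge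
        have h2 : k * √(M - w r) ≤ -w' r := by
          refine le_of_sq_le_sq ?_ (by linarith [hneg r hr'])
          rw [mul_pow, Real.sq_sqrt (by linarith), neg_sq]
          exact h1
        rw [div_le_div_iff₀ (by norm_num) (by positivity)]
        linarith
    rw [ha, sub_self, Real.sqrt_zero, sub_zero] at hmv
    have h2 : √(M - w b) ≤ √M := Real.sqrt_le_sqrt (by linarith)
    rw [le_div_iff₀ hk]
    linarith
  have hi1 : IntervalIntegrable (fun r => w r ^ 2) volume a b :=
    ((hc.mono hs1).pow 2).intervalIntegrable_of_Icc hab.le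
  have hi2 : IntervalIntegrable (fun r => w r ^ 2) volume b e :=
    ((hc.mono hs2).pow 2).intervalIntegrable_of_Icc hbe.le
  rw [← intervalIntegral.integral_add_adjacent_intervals hi1 hi2]
  refine add_le_add ?_ ?_
  · calc ∫ r in a..b, w r ^ 2 ≤ ∫ _ in a..b, M ^ 2 := by
          refine intervalIntegral.integral_mono_on hab.le hi1 intervalIntegrable_const fun r hr => ?_
          refine pow_le_pow_left₀ (hwpos r (hs1 hr)) ?_ 2
          exact ha ▸ hanti.antitoneOn (Set.left_mem_Icc.2 hae.le) (hs1 hr) hr.1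
      _ = M ^ 2 * (b - a) := by rw [intervalIntegral.integral_const, smul_eq_mul, mul_comm]
      _ ≤ _ := by gcongr
  -- Below `θ` one has `w ^ 2 ≤ -w * w' / q`, the derivative of `-w ^ 2 / (2 * q)`.
  · have hci : ContinuousOn (fun r => -(1 / (2 * q)) * (2 * w r * w' r)) (Set.Icc b e) :=
      continuousOn_const.mul ((continuousOn_const.mul (hc.mono hs2)).mul (hc'.mono hs2))
    have key := intervalIntegral.integral_eq_sub_of_hasDerivAt_of_le (a := b) (b := e)
      (f := fun r => -(1 / (2 * q)) * w r ^ 2)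
      (f' := fun r => -(1 / (2 * q)) * (2 * w r * w' r)) hbe.le
      (continuousOn_const.mul ((hc.mono hs2).pow 2))
      (fun r hr => by
        refine (((hd r ⟨hab.trans hr.1, hr.2⟩).pow 2).const_mul _).congr_deriv ?_
        norm_num)
      (hci.intervalIntegrable_of_Icc hbe.le)
    calc ∫ r in b..e, w r ^ 2 ≤ ∫ r in b..e, -(1 / (2 * q)) * (2 * w r * w' r) := by
          refine intervalIntegral.integral_mono_on_of_le_Ioo hbe.le hi2
            (hci.intervalIntegrable_of_Icc hbe.le) fun r hr => ?_
          have hr' : r ∈ Set.Ioo a e := ⟨hab.trans hr.1, hr.2⟩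
          have h0 := hwpos r (Set.Ioo_subset_Icc_self hr')
          have hle : w r ≤ θ := hwb ▸ hanti.antitoneOn hb (Set.Ioo_subset_Icc_self hr') hr.1.le
          have h1 := mul_le_mul_of_nonneg_left (hlow r hr' hle) h0
          have e1 : -(1 / (2 * q)) * (2 * w r * w' r) = (w r * -w' r) / q := by field_simp
          rw [e1, le_div_iff₀ hq]
          nlinarith
      _ = θ ^ 2 / (2 * q) := by rw [key, he, hwb]; ring
      _ ≤ _ := le_rfl

namespace IsRadialProfile

variable {p l : ℝ} {w y : ℝ → ℝ}

/-- The energy `w'² / 2 - l w² / 2 + w ^ p / p` of a planar radial profile. -/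
noncomputable def energy (p l : ℝ) (w y : ℝ → ℝ) (r : ℝ) : ℝ :=
  (y r / r) ^ 2 / 2 - l * w r ^ 2 / 2 + w r ^ p / p

lemma mul_rpow_sub_two {x : ℝ} (hx : 0 ≤ x) (hp : 2 < p) :
    x ^ (p - 2) * x = x ^ (p - 1) ∧ x ^ (p - 1) * x = x ^ p ∧ x ^ (p - 2) * x ^ 2 = x ^ p := by
  have h1 : x ^ (p - 2) * x = x ^ (p - 1) := by
    conv_lhs => rw [← Real.rpow_one x, ← Real.rpow_mul hx, one_mul]
    rw [← Real.rpow_add_of_nonneg hx (by linarith) (by norm_num)]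
    congr 1; ring
  have h2 : x ^ (p - 1) * x = x ^ p := by
    conv_lhs => rw [← Real.rpow_one x, ← Real.rpow_mul hx, one_mul]
    rw [← Real.rpow_add_of_nonneg hx (by linarith) (by norm_num)]
    congr 1; ring
  exact ⟨h1, h2, by rw [pow_two, ← mul_assoc, h1, h2]⟩

lemma hasDerivAt_rpow (h : IsRadialProfile 1 p l w y) (hp : 2 < p) {r : ℝ}
    (hr : r ∈ Set.Ioo (1 : ℝ) 2) :
    HasDerivAt (fun t => w t ^ p) (y r / r * p * w r ^ (p - 1)) r := by
  have := (h.hasDerivAt r hr).rpow_const (p := p) (Or.inr (by linarith))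
  rwa [pow_one] at this

lemma hasDerivAt_planar (h : IsRadialProfile 1 p l w y) (hp : 2 < p) {r : ℝ}
    (hr : r ∈ Set.Ioo (1 : ℝ) 2) :
    HasDerivAt w (y r / r) r ∧ HasDerivAt y (r * (l * w r - w r ^ (p - 1))) r := by
  have h1 := h.hasDerivAt r hr
  have h2 := h.hasDerivAt_flux r hr
  have h0 := h.nonneg (Set.Ioo_subset_Icc_self hr)
  rw [abs_of_nonneg h0, (mul_rpow_sub_two h0 hp).1] at h2
  simpa only [pow_one] using And.intro h1 h2

lemma continuousOn_rpow (h : IsRadialProfile 1 p l w y) (hp : 2 < p) :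
    ContinuousOn (fun t => w t ^ p) (Set.Icc 1 2) :=
  h.continuousOn.rpow_const fun _ _ => Or.inr (by linarith)

lemma continuousOn_deriv (h : IsRadialProfile 1 p l w y) :
    ContinuousOn (fun r => y r / r) (Set.Icc 1 2) :=
  h.continuousOn_flux.div continuousOn_id fun r hr => by
    linarith [hr.1]

/-- The term `w' / r` of the planar Laplacian acts as friction: the energy is lost at rate `w' ^ 2 /
r`. -/
lemma hasDerivAt_energy (h : IsRadialProfile 1 p l w y) (hp : 2 < p) {r : ℝ}
    (hr : r ∈ Set.Ioo (1 : ℝ) 2) :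
    HasDerivAt (energy p l w y) (-(y r ^ 2 / r ^ 3)) r := by
  obtain ⟨h1, h2⟩ := h.hasDerivAt_planar hp hr
  have hr0 : r ≠ 0 := by linarith [hr.1]
  have hp0 : p ≠ 0 := by linarith
  have h3 : HasDerivAt (fun t => y t / t)
      ((r * (l * w r - w r ^ (p - 1)) * r - y r * 1) / r ^ 2) r := h2.div (hasDerivAt_id r) hr0
  refine ((((h3.pow 2).div_const 2).sub (((h1.pow 2).const_mul l).div_const 2)).add
    ((h.hasDerivAt_rpow hp hr).div_const p)).congr_deriv ?_
  norm_num
  field_simp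
  ring

lemma antitoneOn_energy (h : IsRadialProfile 1 p l w y) (hp : 2 < p) :
    AntitoneOn (energy p l w y) (Set.Icc 1 2) := by
  refine antitoneOn_of_deriv_nonpos (convex_Icc 1 2) ?_ ?_ ?_
  · exact (((h.continuousOn_deriv.pow 2).div_const 2).sub
      ((continuousOn_const.mul (h.continuousOn.pow 2)).div_const 2)).add
        ((h.continuousOn_rpow hp).div_const p)
  all_goals rw [interior_Icc]
  · exact fun r hr => (h.hasDerivAt_energy hp hr).differentiableAt.differentiableWithinAt
  · intro r hr
    rw [(h.hasDerivAt_energy hp hr).deriv]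
    have : 0 < r := by linarith [hr.1]
    exact neg_nonpos.2 (by positivity)

/-- At `r = 2` only the kinetic term survives, and the energy decreases towards that value. -/
lemma energy_function_nonneg (h : IsRadialProfile 1 p l w y) (hp : 2 < p) {r : ℝ}
    (hr : r ∈ Set.Icc (1 : ℝ) 2) : 0 ≤ energy p l w y r := by
  have h2 : (2 : ℝ) ∈ Set.Icc (1 : ℝ) 2 := by norm_num
  refine le_trans ?_ (h.antitoneOn_energy hp hr h2 hr.2)
  rw [energy, h.right_eq_zero, Real.zero_rpow (by linarith)]
  have : 0 ≤ (y 2 / 2) ^ 2 := sq_nonneg _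
  rw [zero_div, add_zero]
  linarith

lemma flux_eq_zero_of_isLocalExtr (h : IsRadialProfile 1 p l w y) (hp : 2 < p) {r : ℝ}
    (hr : r ∈ Set.Ioo (1 : ℝ) 2) (hm : IsLocalExtr w r) : y r = 0 := by
  have := hm.hasDerivAt_eq_zero (h.hasDerivAt_planar hp hr).1
  have hr0 : r ≠ 0 := by linarith [hr.1]
  simpa [hr0] using this

/-- An interior zero is a minimum, so the energy vanishes there. Being nonnegative and decreasing,
it vanishes from there on, so there is no more dissipation and `w` stays at `0`, against almost
everywhere positivity. -/
lemma pos (h : IsRadialProfile 1 p l w y) (hp : 2 < p) {c : ℝ}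
    (hc : c ∈ Set.Ioo (1 : ℝ) 2) : 0 < w c := by
  have hc' := Set.Ioo_subset_Icc_self hc
  refine lt_of_le_of_ne (h.nonneg hc') fun hwc => ?_
  have hmin : IsLocalMin w c := by
    filter_upwards [Icc_mem_nhds hc.1 hc.2] with r hr
    rw [← hwc]
    exact h.nonneg hr
  have hyc := h.flux_eq_zero_of_isLocalExtr hp hc (Or.inl hmin)
  have hEc : energy p l w y c = 0 := by
    rw [energy, ← hwc, hyc, Real.zero_rpow (by linarith)]; ring
  have hE : ∀ r ∈ Set.Ioo c 2, energy p l w y r = 0 := by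
    intro r hr
    have hr' : r ∈ Set.Icc (1 : ℝ) 2 := ⟨(hc.1.trans hr.1).le, hr.2.le⟩
    exact le_antisymm (hEc ▸ h.antitoneOn_energy hp hc' hr' hr.1.le)
      (h.energy_function_nonneg hp hr')
  have hy : ∀ r ∈ Set.Ioo c 2, y r = 0 := by
    intro r hr
    have hr' : r ∈ Set.Ioo (1 : ℝ) 2 := ⟨hc.1.trans hr.1, hr.2⟩
    have h0 : HasDerivAt (energy p l w y) 0 r :=
      (hasDerivAt_const r (0 : ℝ)).congr_of_eventuallyEq
        (by filter_upwards [Ioo_mem_nhds hr.1 hr.2] with t ht using hE t ht)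
    have := (h.hasDerivAt_energy hp hr').unique h0
    have hr0 : r ≠ 0 := by linarith [hr'.1]
    simpa [hr0] using this
  obtain ⟨r, hr, hpos⟩ := h.exists_pos_of_isOpen isOpen_Ioo (Set.nonempty_Ioo.2 hc.2)
    (Set.Ioo_subset_Ioo_left hc.1.le)
  obtain ⟨t, ht, hslope⟩ := exists_hasDerivAt_eq_slope w (fun t => y t / t) hr.1
    (h.continuousOn.mono (Set.Icc_subset_Icc hc.1.le hr.2.le))
    fun t ht => (h.hasDerivAt_planar hp ⟨hc.1.trans ht.1, ht.2.trans hr.2⟩).1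
  rw [hy t ⟨ht.1, ht.2.trans hr.2⟩, ← hwc, zero_div, sub_zero, eq_comm,
    div_eq_zero_iff] at hslope
  rcases hslope with h0 | h0
  · exact hpos.ne' h0
  · linarith [hr.1]

/-- At a critical point the profile is above the zero of the potential. -/
lemma le_rpow_of_flux_eq_zero (h : IsRadialProfile 1 p l w y) (hp : 2 < p) {c : ℝ}
    (hc : c ∈ Set.Ioo (1 : ℝ) 2) (hy : y c = 0) : l * p / 2 ≤ w c ^ (p - 2) := by
  have hE := h.energy_function_nonneg hp (Set.Ioo_subset_Icc_self hc)
  have hw := h.pos hp hc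
  rw [energy, hy, zero_div, ← (mul_rpow_sub_two hw.le hp).2.2] at hE
  have h1 : 0 ≤ w c ^ 2 * (w c ^ (p - 2) / p - l / 2) := by
    convert hE using 1; ring
  have h2 : 0 ≤ w c ^ (p - 2) / p - l / 2 := nonneg_of_mul_nonneg_right h1 (by positivity)
  have h3 : l / 2 ≤ w c ^ (p - 2) / p := by linarith
  rw [le_div_iff₀ (by linarith)] at h3
  linarith

/-- Between two critical points the minimum of `w` would also be critical, so `w ^ (p - 2) ≥ l p / 2
> l` throughout. There the flux strictly decreases and cannot vanish at both ends. -/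
lemma flux_ne_zero_of_lt (h : IsRadialProfile 1 p l w y) (hp : 2 < p) (hl : 0 < l) {c d : ℝ}
    (hc : 1 < c) (hcd : c < d) (hd : d < 2) (hyc : y c = 0) : y d ≠ 0 := by
  intro hyd
  have hsub : Set.Icc c d ⊆ Set.Ioo (1 : ℝ) 2 := fun r hr =>
    ⟨hc.trans_le hr.1, hr.2.trans_lt hd⟩
  have hsub' := hsub.trans Set.Ioo_subset_Icc_self
  obtain ⟨m, hm, hmin⟩ := isCompact_Icc.exists_isMinOn (Set.nonempty_Icc.2 hcd.le)
    (h.continuousOn.mono hsub')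
  have hym : y m = 0 := by
    rcases eq_or_lt_of_le hm.1 with h1 | h1
    · rw [← h1, hyc]
    rcases eq_or_lt_of_le hm.2 with h2 | h2
    · rw [h2, hyd]
    exact h.flux_eq_zero_of_isLocalExtr hp (hsub hm)
      (Or.inl (hmin.isLocalMin (Icc_mem_nhds h1 h2)))
  have hwm := h.le_rpow_of_flux_eq_zero hp (hsub hm) hym
  have hanti : StrictAntiOn y (Set.Icc c d) := by
    refine strictAntiOn_of_deriv_neg (convex_Icc c d) (h.continuousOn_flux.mono hsub')
      fun r hr => ?_
    rw [interior_Icc] at hr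
    have hr' := Set.Ioo_subset_Icc_self hr
    have hwr := h.pos hp (hsub hr')
    rw [(h.hasDerivAt_planar hp (hsub hr')).2.deriv, ← (mul_rpow_sub_two hwr.le hp).1]
    have h1 : w m ^ (p - 2) ≤ w r ^ (p - 2) :=
      Real.rpow_le_rpow (h.pos hp (hsub hm)).le (hmin hr') (by linarith)
    have h2 : l < l * p / 2 := by nlinarith
    have h3 : 0 < (w r ^ (p - 2) - l) * w r := mul_pos (by linarith) hwr
    have h4 : 0 < r := by linarith [(hsub hr').1]
    have : 0 < r * ((w r ^ (p - 2) - l) * w r) := mul_pos h4 h3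
    linarith
  have := hanti (Set.left_mem_Icc.2 hcd.le) (Set.right_mem_Icc.2 hcd.le) hcd
  rw [hyc, hyd] at this
  exact lt_irrefl _ this

lemma flux_eq_zero_iff (h : IsRadialProfile 1 p l w y) (hp : 2 < p) (hl : 0 < l) {s r : ℝ}
    (hs : s ∈ Set.Ioo (1 : ℝ) 2) (hr : r ∈ Set.Ioo (1 : ℝ) 2) (hys : y s = 0)
    (hyr : y r = 0) : r = s := by
  rcases lt_trichotomy r s with h1 | h1 | h1
  · exact absurd hys (h.flux_ne_zero_of_lt hp hl hr.1 h1 hs.2 hyr)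
  · exact h1
  · exact absurd hyr (h.flux_ne_zero_of_lt hp hl hs.1 h1 hr.2 hys)

/-- The mean value theorem gives one point with the right sign on each side; a change of sign would
create a second critical point. -/
lemma flux_sign (h : IsRadialProfile 1 p l w y) (hp : 2 < p) (hl : 0 < l) {s : ℝ}
    (hs : s ∈ Set.Ioo (1 : ℝ) 2) (hys : y s = 0) :
    (∀ r ∈ Set.Ioo 1 s, 0 < y r) ∧ ∀ r ∈ Set.Ioo s 2, y r < 0 := by
  have hws := h.pos hp hs
  constructor
  · intro r hr
    obtain ⟨t, ht, hslope⟩ := exists_hasDerivAt_eq_slope w (fun t => y t / t) hs.1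
      (h.continuousOn.mono (Set.Icc_subset_Icc_right hs.2.le))
      fun t ht => (h.hasDerivAt_planar hp ⟨ht.1, ht.2.trans hs.2⟩).1
    have ht0 : 0 < t := by linarith [ht.1]
    have hyt : 0 < y t := by
      have h1 : 0 < y t / t := by
        rw [hslope, h.left_eq_zero]; exact div_pos (by linarith) (by linarith [hs.1])
      exact (div_pos_iff_of_pos_right ht0).1 h1
    by_contra! hle
    have hsub : Set.uIcc r t ⊆ Set.Ioo 1 s := Set.ordConnected_Ioo.uIcc_subset hr ht
    obtain ⟨z, hz, hyz⟩ := intermediate_value_uIcc (a := r) (b := t) (f := y)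
      (h.continuousOn_flux.mono fun z hz => ⟨(hsub hz).1.le, ((hsub hz).2.trans hs.2).le⟩)
      (Set.mem_uIcc_of_le hle hyt.le)
    have := h.flux_eq_zero_iff hp hl hs ⟨(hsub hz).1, (hsub hz).2.trans hs.2⟩ hys hyz
    exact (hsub hz).2.ne this
  · intro r hr
    obtain ⟨t, ht, hslope⟩ := exists_hasDerivAt_eq_slope w (fun t => y t / t) hs.2
      (h.continuousOn.mono (Set.Icc_subset_Icc_left hs.1.le))
      fun t ht => (h.hasDerivAt_planar hp ⟨hs.1.trans ht.1, ht.2⟩).1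
    have ht0 : 0 < t := by linarith [ht.1, hs.1]
    have hyt : y t < 0 := by
      have h1 : y t / t < 0 := by
        rw [hslope, h.right_eq_zero]
        exact div_neg_of_neg_of_pos (by linarith) (by linarith [hs.2])
      by_contra! h2
      exact absurd h1 (not_lt.2 (div_nonneg h2 ht0.le))
    by_contra! hle
    have hsub : Set.uIcc r t ⊆ Set.Ioo s 2 := Set.ordConnected_Ioo.uIcc_subset hr ht
    obtain ⟨z, hz, hyz⟩ := intermediate_value_uIcc (a := r) (b := t) (f := y)
      (h.continuousOn_flux.mono fun z hz => ⟨(hs.1.trans (hsub hz).1).le, (hsub hz).2.le⟩)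
      (Set.mem_uIcc_of_ge hyt.le hle)
    have := h.flux_eq_zero_iff hp hl hs ⟨hs.1.trans (hsub hz).1, (hsub hz).2⟩ hys hyz
    exact (hsub hz).1.ne' this

/-- Below `θ` the term `w ^ p / p` absorbs at most half of `l w ^ 2 / 2`; nonnegative energy leaves
the other half to `w' ^ 2`. -/
lemma mul_le_abs_deriv (h : IsRadialProfile 1 p l w y) (hp : 2 < p) (hl : 0 < l) {θ r : ℝ}
    (hθ : θ ^ (p - 2) = l * p / 4) (hr : r ∈ Set.Ioo (1 : ℝ) 2) (hle : w r ≤ θ) :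
    √(l / 2) * w r ≤ |y r / r| := by
  have hw := h.pos hp hr
  have hE := h.energy_function_nonneg hp (Set.Ioo_subset_Icc_self hr)
  rw [energy, ← (mul_rpow_sub_two hw.le hp).2.2] at hE
  have h1 : w r ^ (p - 2) ≤ l * p / 4 := hθ ▸ Real.rpow_le_rpow hw.le hle (by linarith)
  have h2 : w r ^ (p - 2) * w r ^ 2 / p ≤ l / 4 * w r ^ 2 := by
    rw [div_le_iff₀ (by linarith)]
    have := mul_le_mul_of_nonneg_right h1 (sq_nonneg (w r))
    linarith
  refine le_of_sq_le_sq ?_ (abs_nonneg _)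
  rw [mul_pow, Real.sq_sqrt (by positivity), sq_abs]
  linarith

/-- The energy decreases in `r`, so it gives no lower bound for `w'` to the right of the peak in
terms of its value there. This quantity uses the flux instead of `w'`, which removes the friction
term, and has a smaller potential; it works on both sides. -/
lemma hasDerivAt_flux_sq_add (h : IsRadialProfile 1 p l w y) (hp : 2 < p) {r : ℝ}
    (hr : r ∈ Set.Ioo (1 : ℝ) 2) :
    HasDerivAt (fun t => y t ^ 2 + 2 / (3 * p) * w t ^ p)
      (y r * (2 * r * (l * w r - w r ^ (p - 1)) + 2 / 3 * w r ^ (p - 1) / r)) r := by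
  have hr0 : r ≠ 0 := by linarith [hr.1]
  have hp0 : p ≠ 0 := by linarith
  refine (((h.hasDerivAt_planar hp hr).2.pow 2).add
    ((h.hasDerivAt_rpow hp hr).const_mul (2 / (3 * p)))).congr_deriv ?_
  norm_num
  field_simp

/-- Here `p ≥ 6` matters: `w ^ (p - 2) ≥ l p / 4 ≥ 3 l / 2`, so the linear term costs at most two
thirds of the nonlinear one. The remaining third pays for the added potential, as `r ≥ 1`. -/
lemma flux_factor_nonpos (h : IsRadialProfile 1 p l w y) (hp : 6 ≤ p) (hl : 0 < l) {θ r : ℝ}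
    (hθ0 : 0 < θ) (hθ : θ ^ (p - 2) = l * p / 4) (hr : r ∈ Set.Ioo (1 : ℝ) 2)
    (hle : θ ≤ w r) :
    2 * r * (l * w r - w r ^ (p - 1)) + 2 / 3 * w r ^ (p - 1) / r ≤ 0 := by
  have hw := h.pos (by linarith) hr
  have h1 : l * p / 4 ≤ w r ^ (p - 2) := hθ ▸ Real.rpow_le_rpow hθ0.le hle (by linarith)
  have h2 : l ≤ 2 / 3 * w r ^ (p - 2) := by nlinarith
  have h3 : l * w r ≤ 2 / 3 * w r ^ (p - 1) := by
    rw [← (mul_rpow_sub_two hw.le (by linarith : 2 < p)).1]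
    nlinarith
  have h4 : 0 < w r ^ (p - 1) := Real.rpow_pos_of_pos hw _
  have h5 : 2 / 3 * w r ^ (p - 1) / r ≤ 2 / 3 * w r ^ (p - 1) :=
    div_le_self (by positivity) hr.1.le
  nlinarith [hr.1]

/-- Since `x ^ p ≤ M ^ (p - 1) * x`, the potential difference is at least linear in `M - x`;
dividing by `r ^ 2 ≤ 4` turns `2 / (3 p)` into `1 / (6 p)`. -/
lemma le_deriv_sq_of_flux_sq {M x r : ℝ} {Y : ℝ} (hp : 2 < p) (hr : r ∈ Set.Ioo (1 : ℝ) 2)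
    (hx : 0 ≤ x) (hxM : x ≤ M)
    (hY : 2 / (3 * p) * M ^ p ≤ Y ^ 2 + 2 / (3 * p) * x ^ p) :
    √(M ^ (p - 1) / (6 * p)) ^ 2 * (M - x) ≤ (Y / r) ^ 2 := by
  have hM : 0 ≤ M := hx.trans hxM
  have hMp : 0 ≤ M ^ (p - 1) := Real.rpow_nonneg hM _
  rw [Real.sq_sqrt (by positivity)]
  have h1 : x ^ p ≤ M ^ (p - 1) * x := by
    rw [← (mul_rpow_sub_two hx hp).2.1]
    exact mul_le_mul_of_nonneg_right (Real.rpow_le_rpow hx hxM (by linarith)) hx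
  rw [← (mul_rpow_sub_two hM hp).2.1] at hY
  have h2 : 2 / (3 * p) * (M ^ (p - 1) * (M - x)) ≤ Y ^ 2 := by
    have : 2 / (3 * p) * x ^ p ≤ 2 / (3 * p) * (M ^ (p - 1) * x) := by gcongr
    linarith
  have hr0 : 0 < r := by linarith [hr.1]
  rw [div_pow, le_div_iff₀ (by positivity)]
  have h3 : r ^ 2 ≤ 4 := by nlinarith [hr.2]
  calc M ^ (p - 1) / (6 * p) * (M - x) * r ^ 2 ≤ M ^ (p - 1) / (6 * p) * (M - x) * 4 := by
        have : 0 ≤ M - x := by linarith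
        gcongr
    _ = 2 / (3 * p) * (M ^ (p - 1) * (M - x)) := by field_simp; ring
    _ ≤ _ := h2

/-- For `p ≥ 6` the mass of a planar profile is at most of order `θ ^ (3 - p / 2)`, where
`θ ^ (p - 2) = l p / 4`. -/
theorem integral_sq_le (h : IsRadialProfile 1 p l w y) (hp : 6 ≤ p) (hl : 0 < l) {θ : ℝ}
    (hθ0 : 0 < θ) (hθ : θ ^ (p - 2) = l * p / 4) :
    ∫ r in (1 : ℝ)..2, w r ^ 2 ≤ (4 * √(6 * p) + √(p / 2)) * θ ^ (3 - p / 2) := by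
  have hp2 : 2 < p := by linarith
  obtain ⟨s, hs, hM, hmax⟩ := h.exists_max
  have hys : y s = 0 := h.flux_eq_zero_of_isLocalExtr hp2 hs (Or.inr (by
    filter_upwards [Icc_mem_nhds hs.1 hs.2] with r hr using hmax r hr))
  obtain ⟨hypos, hyneg⟩ := h.flux_sign hp2 hl hs hys
  have hθM : θ < w s := by
    have h1 := h.le_rpow_of_flux_eq_zero hp2 hs hys
    have h2 : θ ^ (p - 2) < w s ^ (p - 2) := by
      have : 0 < l * p := by positivity
      rw [hθ]; linarith
    exact (Real.rpow_lt_rpow_iff hθ0.le hM.le (by linarith)).1 h2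
  set M := w s with hMdef
  set k := √(M ^ (p - 1) / (6 * p)) with hk
  have hMp : 0 < M ^ (p - 1) := Real.rpow_pos_of_pos hM _
  have hk0 : 0 < k := Real.sqrt_pos.2 (by positivity)
  have hq0 : 0 < √(l / 2) := Real.sqrt_pos.2 (by positivity)
  have hsubR : Set.Icc s 2 ⊆ Set.Icc (1 : ℝ) 2 := Set.Icc_subset_Icc_left hs.1.le
  have hsubL : Set.Icc 1 s ⊆ Set.Icc (1 : ℝ) 2 := Set.Icc_subset_Icc_right hs.2.le
  have hmemR : ∀ r ∈ Set.Ioo s 2, r ∈ Set.Ioo (1 : ℝ) 2 := fun r hr => ⟨hs.1.trans hr.1, hr.2⟩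
  have hmemL : ∀ r ∈ Set.Ioo 1 s, r ∈ Set.Ioo (1 : ℝ) 2 := fun r hr => ⟨hr.1, hr.2.trans hs.2⟩
  have hposr : ∀ r ∈ Set.Ioo (1 : ℝ) 2, 0 < r := fun r hr => by linarith [hr.1]
  have hantiR : AntitoneOn w (Set.Icc s 2) := by
    refine antitoneOn_of_deriv_nonpos (convex_Icc s 2) (h.continuousOn.mono hsubR) ?_ ?_
    all_goals rw [interior_Icc]
    · exact fun r hr =>
        (h.hasDerivAt_planar hp2 (hmemR r hr)).1.differentiableAt.differentiableWithinAt
    · intro r hr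
      rw [(h.hasDerivAt_planar hp2 (hmemR r hr)).1.deriv]
      exact div_nonpos_of_nonpos_of_nonneg (hyneg r hr).le (hposr r (hmemR r hr)).le
  have hmonoL : MonotoneOn w (Set.Icc 1 s) := by
    refine monotoneOn_of_deriv_nonneg (convex_Icc 1 s) (h.continuousOn.mono hsubL) ?_ ?_
    all_goals rw [interior_Icc]
    · exact fun r hr =>
        (h.hasDerivAt_planar hp2 (hmemL r hr)).1.differentiableAt.differentiableWithinAt
    · intro r hr
      rw [(h.hasDerivAt_planar hp2 (hmemL r hr)).1.deriv]
      exact div_nonneg (hypos r hr).le (hposr r (hmemL r hr)).le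
  have hQc : ContinuousOn (fun t => y t ^ 2 + 2 / (3 * p) * w t ^ p) (Set.Icc 1 2) :=
    (h.continuousOn_flux.pow 2).add (continuousOn_const.mul (h.continuousOn_rpow hp2))
  have hright : ∫ r in s..2, w r ^ 2 ≤ M ^ 2 * (2 * √M / k) + θ ^ 2 / (2 * √(l / 2)) := by
    refine integral_sq_le_of_descent (w' := fun r => y r / r) hs.2 (h.continuousOn.mono hsubR)
      (h.continuousOn_deriv.mono hsubR) (fun r hr => (h.hasDerivAt_planar hp2 (hmemR r hr)).1)
      (fun r hr => div_neg_of_neg_of_pos (hyneg r hr) (hposr r (hmemR r hr)))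
      rfl h.right_eq_zero hθ0 hθM hq0 hk0 ?_ ?_
    · intro r hr hle
      have := h.mul_le_abs_deriv hp2 hl hθ (hmemR r hr) hle
      rwa [abs_of_neg (div_neg_of_neg_of_pos (hyneg r hr) (hposr r (hmemR r hr)))] at this
    · intro r hr hge
      have hrI := hmemR r hr
      refine le_deriv_sq_of_flux_sq hp2 hrI (h.pos hp2 hrI).le
        (hmax r (Set.Ioo_subset_Icc_self hrI)) ?_
      have hmono : MonotoneOn (fun t => y t ^ 2 + 2 / (3 * p) * w t ^ p) (Set.Icc s r) := by
        have hsr : ∀ t ∈ Set.Ioo s r, t ∈ Set.Ioo s 2 := fun t ht => ⟨ht.1, ht.2.trans hr.2⟩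
        refine monotoneOn_of_deriv_nonneg (convex_Icc s r)
          (hQc.mono ((Set.Icc_subset_Icc_right hr.2.le).trans hsubR)) ?_ ?_
        all_goals rw [interior_Icc]
        · exact fun t ht => (h.hasDerivAt_flux_sq_add hp2
            (hmemR t (hsr t ht))).differentiableAt.differentiableWithinAt
        · intro t ht
          rw [(h.hasDerivAt_flux_sq_add hp2 (hmemR t (hsr t ht))).deriv]
          refine mul_nonneg_of_nonpos_of_nonpos (hyneg t (hsr t ht)).le
            (h.flux_factor_nonpos hp hl hθ0 hθ (hmemR t (hsr t ht)) ?_)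
          exact hge.trans (hantiR (Set.Ioo_subset_Icc_self (hsr t ht))
            (Set.Ioo_subset_Icc_self hr) ht.2.le)
      have := hmono (Set.left_mem_Icc.2 hr.1.le) (Set.right_mem_Icc.2 hr.1.le) hr.1.le
      simpa [hys] using this
  have hleft : ∫ r in (1 : ℝ)..s, w r ^ 2
      ≤ M ^ 2 * (2 * √M / k) + θ ^ 2 / (2 * √(l / 2)) := by
    -- Reflection makes the increasing side a descent from the peak, so the same lemma applies.
    have hneg : ∫ r in (-s)..(-1), w (-r) ^ 2 = ∫ r in (1 : ℝ)..s, w r ^ 2 := by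
      rw [intervalIntegral.integral_comp_neg (fun r => w r ^ 2), neg_neg, neg_neg]
    rw [← hneg]
    have hmapsC : Set.MapsTo (fun r : ℝ => -r) (Set.Icc (-s) (-1)) (Set.Icc (1 : ℝ) 2) :=
      fun r hr => hsubL ⟨by linarith [hr.2], by linarith [hr.1]⟩
    have hmaps : ∀ r ∈ Set.Ioo (-s) (-1), -r ∈ Set.Ioo 1 s :=
      fun r hr => ⟨by linarith [hr.2], by linarith [hr.1]⟩
    refine integral_sq_le_of_descent (w := fun r => w (-r)) (w' := fun r => -(y (-r) / (-r)))
      (by linarith [hs.1]) (h.continuousOn.comp continuousOn_neg hmapsC)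
      (h.continuousOn_deriv.comp continuousOn_neg hmapsC).neg
      (fun r hr => ?_) (fun r hr => ?_)
      (by rw [neg_neg]) (by rw [neg_neg]; exact h.left_eq_zero) hθ0 hθM hq0 hk0 ?_ ?_
    · have h1 := (h.hasDerivAt_planar hp2 (hmemL _ (hmaps r hr))).1
      refine (h1.comp r (hasDerivAt_neg r)).congr_deriv ?_
      ring
    · exact neg_neg_of_pos (div_pos (hypos _ (hmaps r hr)) (hposr _ (hmemL _ (hmaps r hr))))
    · intro r hr hle
      have := h.mul_le_abs_deriv hp2 hl hθ (hmemL _ (hmaps r hr)) hle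
      rw [abs_of_pos (div_pos (hypos _ (hmaps r hr)) (hposr _ (hmemL _ (hmaps r hr))))] at this
      rwa [neg_neg]
    · intro r hr hge
      have hr' := hmaps r hr
      have hrI := hmemL _ hr'
      rw [neg_sq]
      refine le_deriv_sq_of_flux_sq hp2 hrI (h.pos hp2 hrI).le
        (hmax _ (Set.Ioo_subset_Icc_self hrI)) ?_
      have hanti : AntitoneOn (fun t => y t ^ 2 + 2 / (3 * p) * w t ^ p) (Set.Icc (-r) s) := by
        have hsr : ∀ t ∈ Set.Ioo (-r) s, t ∈ Set.Ioo 1 s := fun t ht => ⟨hr'.1.trans ht.1, ht.2⟩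
        refine antitoneOn_of_deriv_nonpos (convex_Icc (-r) s)
          (hQc.mono ((Set.Icc_subset_Icc_left hr'.1.le).trans hsubL)) ?_ ?_
        all_goals rw [interior_Icc]
        · exact fun t ht => (h.hasDerivAt_flux_sq_add hp2
            (hmemL t (hsr t ht))).differentiableAt.differentiableWithinAt
        · intro t ht
          rw [(h.hasDerivAt_flux_sq_add hp2 (hmemL t (hsr t ht))).deriv]
          refine mul_nonpos_of_nonneg_of_nonpos (hypos t (hsr t ht)).le
            (h.flux_factor_nonpos hp hl hθ0 hθ (hmemL t (hsr t ht)) ?_)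
          exact hge.trans (hmonoL (Set.Ioo_subset_Icc_self hr')
            (Set.Ioo_subset_Icc_self (hsr t ht)) ht.1.le)
      have := hanti (Set.left_mem_Icc.2 hr'.2.le) (Set.right_mem_Icc.2 hr'.2.le) hr'.2.le
      simpa [hys] using this
  have hcsq : ContinuousOn (fun r => w r ^ 2) (Set.Icc 1 2) := h.continuousOn.pow 2
  rw [← intervalIntegral.integral_add_adjacent_intervals
    ((hcsq.mono hsubL).intervalIntegrable_of_Icc hs.1.le)
    ((hcsq.mono hsubR).intervalIntegrable_of_Icc hs.2.le)]
  have hhigh : M ^ 2 * (2 * √M / k) = 2 * √(6 * p) * M ^ (3 - p / 2) := by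
    have e1 : k = M ^ ((p - 1) / 2) / √(6 * p) := by
      rw [hk, Real.sqrt_div hMp.le, Real.sqrt_eq_rpow (M ^ (p - 1)), ← Real.rpow_mul hM.le]
      congr 2; ring
    have e2 : M ^ (3 - p / 2) * M ^ ((p - 1) / 2) = M ^ 2 * √M := by
      rw [Real.sqrt_eq_rpow, ← Real.rpow_natCast, ← Real.rpow_add hM, ← Real.rpow_add hM]
      congr 1; push_cast; ring
    have h6 : 0 < √(6 * p) := Real.sqrt_pos.2 (by positivity)
    have hMh : 0 < M ^ ((p - 1) / 2) := Real.rpow_pos_of_pos hM _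
    rw [e1, div_div_eq_mul_div, mul_div_assoc', div_eq_iff hMh.ne']
    linear_combination (-2 * √(6 * p)) * e2
  have hlow : θ ^ 2 / √(l / 2) = √(p / 2) * θ ^ (3 - p / 2) := by
    have hp0 : 0 < p := by linarith
    have e1 : √(p / 2) * √(l / 2) = θ ^ ((p - 2) / 2) := by
      rw [← Real.sqrt_mul (by positivity), show p / 2 * (l / 2) = θ ^ (p - 2) by rw [hθ]; ring,
        Real.sqrt_eq_rpow, ← Real.rpow_mul hθ0.le]
      congr 1; ring
    have e2 : θ ^ ((p - 2) / 2) * θ ^ (3 - p / 2) = θ ^ 2 := by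
      rw [← Real.rpow_natCast, ← Real.rpow_add hθ0]
      congr 1; push_cast; ring
    rw [div_eq_iff hq0.ne', ← e2, ← e1]
    ring
  -- The exponent is nonpositive for `p ≥ 6`, so the unknown height `M` may be replaced by `θ`.
  have hdecr : M ^ (3 - p / 2) ≤ θ ^ (3 - p / 2) :=
    Real.rpow_le_rpow_of_nonpos hθ0 hθM.le (by linarith)
  have hhigh' : M ^ 2 * (2 * √M / k) ≤ 2 * √(6 * p) * θ ^ (3 - p / 2) := by
    rw [hhigh]; gcongr
  have hhalf : θ ^ 2 / (2 * √(l / 2)) = √(p / 2) * θ ^ (3 - p / 2) / 2 := by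
    rw [← hlow, div_div, mul_comm]
  rw [hhalf] at hleft hright
  linarith

end IsRadialProfile

/-! ### Polar coordinates on the annulus. -/

/-- The radial part `r ^ n dr` of Lebesgue measure on the annulus `1 < |x| < 2`. -/
noncomputable def radialMeasure (n : ℕ) : Measure ℝ :=
  (volume.restrict (Set.Ioo 1 2)).withDensity fun r => ENNReal.ofReal (r ^ n)

lemma measurePreserving_coe_radialMeasure (n : ℕ) :
    MeasurePreserving (Subtype.val : Set.Ioi (0 : ℝ) → ℝ)
      ((Measure.volumeIoiPow n).restrict (Subtype.val ⁻¹' Set.Ioo 1 2)) (radialMeasure n) := by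
  refine ⟨measurable_subtype_coe, ?_⟩
  ext s hs
  have hpre : MeasurableSet ((Subtype.val : Set.Ioi (0 : ℝ) → ℝ) ⁻¹' Set.Ioo 1 2) :=
    measurable_subtype_coe measurableSet_Ioo
  rw [Measure.map_apply measurable_subtype_coe hs,
    Measure.restrict_apply (measurable_subtype_coe hs), Measure.volumeIoiPow,
    withDensity_apply _ ((measurable_subtype_coe hs).inter hpre), radialMeasure,
    withDensity_apply _ hs, Measure.restrict_restrict hs,
    setLIntegral_subtype measurableSet_Ioi _ (fun a : ℝ => ENNReal.ofReal (a ^ n)),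
    ← Set.preimage_inter, Subtype.image_preimage_coe]
  congr 2
  ext r
  simp only [Set.mem_inter_iff, Set.mem_Ioi, Set.mem_Ioo]
  constructor
  · rintro ⟨-, h⟩; exact h
  · rintro ⟨h1, h2⟩; exact ⟨by linarith, h1, h2⟩

instance (n : ℕ) : IsFiniteMeasure (radialMeasure n) := by
  refine isFiniteMeasure_withDensity_ofReal ?_
  have : IntegrableOn (fun r : ℝ => r ^ n) (Set.Ioo 1 2) :=
    ((continuous_pow n).integrableOn_Icc (a := 1) (b := 2)).mono_set Set.Ioo_subset_Icc_self
  exact this.2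

/-- The density is at least `1` on the interval, so weighted `L¹` convergence implies unweighted
convergence. -/
lemma restrict_le_radialMeasure (n : ℕ) :
    volume.restrict (Set.Ioo (1 : ℝ) 2) ≤ radialMeasure n := by
  conv_lhs => rw [← withDensity_one (μ := volume.restrict (Set.Ioo (1 : ℝ) 2))]
  refine withDensity_mono ?_
  filter_upwards [ae_restrict_mem measurableSet_Ioo] with r hr
  simp only [Pi.one_apply]
  rw [← ENNReal.ofReal_one]
  exact ENNReal.ofReal_le_ofReal (one_le_pow₀ hr.1.le)

lemma radialMeasure_absolutelyContinuous (n : ℕ) :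
    radialMeasure n ≪ volume.restrict (Set.Ioo (1 : ℝ) 2) :=
  withDensity_absolutelyContinuous _ _

lemma integral_radialMeasure (n : ℕ) (f : ℝ → ℝ) :
    ∫ r, f r ∂(radialMeasure n) = ∫ r in Set.Ioo (1 : ℝ) 2, r ^ n * f r := by
  rw [radialMeasure, integral_withDensity_eq_integral_toReal_smul (by fun_prop) (by simp)]
  refine setIntegral_congr_fun measurableSet_Ioo fun r hr => ?_
  have : 0 ≤ r ^ n := pow_nonneg (by linarith [hr.1]) n
  simp [ENNReal.toReal_ofReal this]

lemma measurableSet_annulus (N : ℕ) : MeasurableSet (annulus N) :=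
  (measurable_norm measurableSet_Ioi).inter (measurable_norm measurableSet_Iio)

/-- Polar coordinates on the annulus. -/
def polar {N : ℕ} (q : ℝ × Metric.sphere (0 : EuclideanSpace ℝ (Fin N)) 1) :
    EuclideanSpace ℝ (Fin N) := q.1 • (q.2 : EuclideanSpace ℝ (Fin N))

lemma continuous_polar {N : ℕ} : Continuous (polar (N := N)) :=
  continuous_fst.smul (continuous_subtype_val.comp continuous_snd)

lemma norm_polar {N : ℕ} {r : ℝ} (hr : 0 ≤ r)
    (θ : Metric.sphere (0 : EuclideanSpace ℝ (Fin N)) 1) : ‖polar (r, θ)‖ = r := by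
  simp [polar, norm_smul, abs_of_nonneg hr]

/-- Surface measure on the unit sphere. -/
noncomputable abbrev sphereMeasure (N : ℕ) :
    Measure (Metric.sphere (0 : EuclideanSpace ℝ (Fin N)) 1) :=
  (volume : Measure (EuclideanSpace ℝ (Fin N))).toSphere

/-- The polar decomposition of the punctured space, restricted to the annulus, with the factors
swapped to put the radius first. -/
lemma measurePreserving_polar (N : ℕ) :
    MeasurePreserving (polar (N := N)) ((radialMeasure (N - 1)).prod (sphereMeasure N))
      (volume.restrict (annulus N)) := by
  have h1 := (volume : Measure (EuclideanSpace ℝ (Fin N))).measurePreserving_homeomorphUnitSphereProd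
  rw [finrank_euclideanSpace, Fintype.card_fin] at h1
  have h2 := h1.symm (homeomorphUnitSphereProd (EuclideanSpace ℝ (Fin N))).toMeasurableEquiv
  have h3 := (measurePreserving_subtype_coe (μa := (volume : Measure (EuclideanSpace ℝ (Fin N))))
    (measurableSet_singleton (0 : EuclideanSpace ℝ (Fin N))).compl).comp h2
  have h4 := h3.restrict_preimage (measurableSet_annulus N)
  have hsub : annulus N ⊆ {0}ᶜ := by
    rintro x hx rfl
    have := hx.1
    simp at this
    linarith
  rw [Measure.restrict_restrict (measurableSet_annulus N), Set.inter_eq_left.2 hsub] at h4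
  have hpre : (Subtype.val ∘ (homeomorphUnitSphereProd
      (EuclideanSpace ℝ (Fin N))).toMeasurableEquiv.symm) ⁻¹' annulus N
      = Set.univ ×ˢ (Subtype.val ⁻¹' Set.Ioo 1 2) := by
    ext ⟨θ, r⟩
    have hr : (0 : ℝ) < r.1 := r.2
    simp [annulus, norm_smul, abs_of_pos hr]
  rw [hpre, ← Measure.prod_restrict, Measure.restrict_univ] at h4
  have h5 := (MeasurePreserving.id (sphereMeasure N)).prod
    (measurePreserving_coe_radialMeasure (N - 1))
  have h6 : MeasurePreserving (fun q : Metric.sphere (0 : EuclideanSpace ℝ (Fin N)) 1 × ℝ =>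
      polar (q.2, q.1)) ((sphereMeasure N).prod (radialMeasure (N - 1)))
      (volume.restrict (annulus N)) := by
    have hm : Measurable fun q : Metric.sphere (0 : EuclideanSpace ℝ (Fin N)) 1 × ℝ =>
      polar (q.2, q.1) := (continuous_polar.comp (continuous_snd.prodMk continuous_fst)).measurable
    refine ⟨hm, ?_⟩
    rw [← h5.map_eq, Measure.map_map hm h5.measurable, ← h4.map_eq]
    rfl
  exact h6.comp Measure.measurePreserving_swap

/-! ### Weak derivatives on an interval and regularity of the radial equation. -/

/-- The primitive of a mean-zero test function on an interval is a test function. -/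
lemma exists_primitive_test {a b : ℝ} (hab : a < b) {χ : ℝ → ℝ} (hχ : ContDiff ℝ ∞ χ)
    (hcs : HasCompactSupport χ) (hsub : tsupport χ ⊆ Set.Ioo a b) (hint : ∫ x, χ x = 0) :
    ∃ ψ : ℝ → ℝ, ContDiff ℝ ∞ ψ ∧ HasCompactSupport ψ ∧ tsupport ψ ⊆ Set.Ioo a b ∧
      deriv ψ = χ := by
  obtain ⟨α, β, hα, hβ, hαβ⟩ : ∃ α β, a < α ∧ β < b ∧ tsupport χ ⊆ Set.Icc α β := by
    rcases (tsupport χ).eq_empty_or_nonempty with he | hne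
    -- For empty support the witnesses are reversed, so that `Set.Icc b a` is empty too.
    · exact ⟨b, a, hab, hab, by simp [he]⟩
    · obtain ⟨α, hα⟩ := IsCompact.exists_isLeast hcs hne
      obtain ⟨β, hβ⟩ := IsCompact.exists_isGreatest hcs hne
      exact ⟨α, β, (hsub hα.1).1, (hsub hβ.1).2, fun x hx => ⟨hα.2 hx, hβ.2 hx⟩⟩
  have hzero : ∀ x, x ∉ Set.Icc α β → χ x = 0 := fun x hx =>
    image_eq_zero_of_notMem_tsupport fun h => hx (hαβ h)
  have hd : ∀ r, HasDerivAt (fun r => ∫ t in a..r, χ t) (χ r) r := fun r =>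
    intervalIntegral.integral_hasDerivAt_right (hχ.continuous.intervalIntegrable _ _)
      (hχ.continuous.stronglyMeasurableAtFilter _ _) hχ.continuous.continuousAt
  have hderiv : deriv (fun r => ∫ t in a..r, χ t) = χ := funext fun r => (hd r).deriv
  have htot : ∫ t in a..b, χ t = 0 := by
    rw [intervalIntegral.integral_eq_integral_of_support_subset, hint]
    exact (subset_tsupport χ).trans (hsub.trans Set.Ioo_subset_Ioc_self)
  have hsupp : Function.support (fun r => ∫ t in a..r, χ t) ⊆ Set.Icc α β := by
    intro r hr
    by_contra hr'
    apply hr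
    rw [Set.mem_Icc, not_and_or, not_le, not_le] at hr'
    rcases hr' with h1 | h1
    · refine intervalIntegral.integral_zero_ae (ae_of_all _ fun t ht => hzero t fun ht' => ?_)
      have : t ≤ max a r := ht.2
      rcases le_max_iff.1 this with h2 | h2 <;> linarith [ht'.1]
    · have h2 : ∫ t in r..b, χ t = 0 := by
        refine intervalIntegral.integral_zero_ae (ae_of_all _ fun t ht => hzero t fun ht' => ?_)
        have : min r b < t := ht.1
        rcases min_lt_iff.1 this with h2 | h2 <;> linarith [ht'.2]
      have h3 := intervalIntegral.integral_add_adjacent_intervals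
        (hχ.continuous.intervalIntegrable (μ := volume) a r)
        (hχ.continuous.intervalIntegrable (μ := volume) r b)
      rw [h2, htot, add_zero] at h3
      exact h3
  have hts : tsupport (fun r => ∫ t in a..r, χ t) ⊆ Set.Icc α β :=
    closure_minimal hsupp isClosed_Icc
  refine ⟨fun r => ∫ t in a..r, χ t, ?_, HasCompactSupport.of_support_subset_isCompact
    isCompact_Icc hsupp, fun x hx => ⟨hα.trans_le (hts hx).1, (hts hx).2.trans_lt hβ⟩, hderiv⟩
  rw [contDiff_infty_iff_deriv, hderiv]
  exact ⟨fun r => (hd r).differentiableAt, hχ⟩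

/-- The lemma of du Bois-Reymond. -/
lemma exists_ae_eq_const_of_integral_mul_deriv {a b : ℝ} (hab : a < b) {m : ℝ → ℝ}
    (hm : IntegrableOn m (Set.Ioo a b))
    (h : ∀ ψ : ℝ → ℝ, ContDiff ℝ ∞ ψ → HasCompactSupport ψ → tsupport ψ ⊆ Set.Ioo a b →
      ∫ r in Set.Ioo a b, m r * deriv ψ r = 0) :
    ∃ c, ∀ᵐ r ∂(volume.restrict (Set.Ioo a b)), m r = c := by
  let f : ContDiffBump ((a + b) / 2) := ⟨(b - a) / 8, (b - a) / 4, by linarith, by linarith⟩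
  set χ : ℝ → ℝ := f.normed volume with hχdef
  have hχ : ContDiff ℝ ∞ χ := f.contDiff_normed
  have hχc : HasCompactSupport χ := f.hasCompactSupport_normed
  have hχs : tsupport χ ⊆ Set.Ioo a b := by
    rw [hχdef, f.tsupport_normed_eq, Real.closedBall_eq_Icc]
    change Set.Icc ((a + b) / 2 - (b - a) / 4) ((a + b) / 2 + (b - a) / 4) ⊆ _
    exact fun x hx => ⟨by linarith [hx.1], by linarith [hx.2]⟩
  have hχ1 : ∫ x, χ x = 1 := f.integral_normed
  have hmul : ∀ η : ℝ → ℝ, Continuous η → HasCompactSupport η →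
      IntegrableOn (fun r => m r * η r) (Set.Ioo a b) := by
    intro η hη hηc
    obtain ⟨C, hC⟩ := hηc.exists_bound_of_continuous hη
    exact hm.mul_bdd hη.aestronglyMeasurable (ae_of_all _ hC)
  have hsupp : ∀ η : ℝ → ℝ, tsupport η ⊆ Set.Ioo a b →
      ∫ r in Set.Ioo a b, η r = ∫ r, η r := fun η hη =>
    setIntegral_eq_integral_of_forall_compl_eq_zero fun x hx =>
      image_eq_zero_of_notMem_tsupport fun h' => hx (hη h')
  set c := ∫ r in Set.Ioo a b, m r * χ r with hc
  refine ⟨c, ?_⟩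
  have hkey : ∀ᵐ x ∂(volume : Measure ℝ), x ∈ Set.Ioo a b → m x - c = 0 := by
    refine isOpen_Ioo.ae_eq_zero_of_integral_contDiff_smul_eq_zero
      (f := fun x => m x - c) ?_ fun η hη hηc hηs => ?_
    · exact (hm.sub (integrableOn_const (by simp))).locallyIntegrableOn
    set A := ∫ x, η x with hA
    -- Subtracting `A * χ` removes the mean of `η`, so the difference is the derivative of a test
    -- function.
    have hθ : ContDiff ℝ ∞ fun x => η x - A * χ x := hη.sub (contDiff_const.mul hχ)
    have hAχ : HasCompactSupport fun x => A * χ x := hχc.mul_left (f := fun _ => A)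
    have hθs : tsupport (fun x => η x - A * χ x) ⊆ Set.Ioo a b := by
      refine (tsupport_sub η (fun x => A * χ x)).trans (Set.union_subset hηs ?_)
      exact (tsupport_mul_subset_right (f := fun _ => A)).trans hχs
    have iη := hη.continuous.integrable_of_hasCompactSupport (μ := volume) hηc
    have iχ := hχ.continuous.integrable_of_hasCompactSupport (μ := volume) hχc
    have hθ0 : ∫ x, (η x - A * χ x) = 0 := by
      rw [integral_sub iη (iχ.const_mul A), integral_const_mul, hχ1, ← hA]; ring
    obtain ⟨ψ, hψ, hψc, hψs, hψd⟩ := exists_primitive_test hab hθ (hηc.sub hAχ) hθs hθ0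
    have h0 := h ψ hψ hψc hψs
    rw [hψd] at h0
    have e1 : ∫ r in Set.Ioo a b, m r * (η r - A * χ r)
        = (∫ r in Set.Ioo a b, m r * η r) - A * c := by
      rw [hc, ← integral_const_mul, ← integral_sub (hmul η hη.continuous hηc)
        ((hmul χ hχ.continuous hχc).const_mul A)]
      congr 1; ext r; ring
    have e2 : ∫ x, η x • (m x - c) = ∫ r in Set.Ioo a b, η r • (m r - c) :=
      (hsupp (fun x => η x • (m x - c))
        ((tsupport_mul_subset_left (f := η) (g := fun x => m x - c)).trans hηs)).symm
    rw [e2]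
    have e3 : ∫ r in Set.Ioo a b, η r • (m r - c)
        = (∫ r in Set.Ioo a b, m r * η r) - c * ∫ r in Set.Ioo a b, η r := by
      rw [← integral_const_mul, ← integral_sub (hmul η hη.continuous hηc)
        (iη.integrableOn.const_mul c)]
      congr 1; ext r; simp only [smul_eq_mul]; ring
    rw [e3, hsupp η hηs, ← hA]
    rw [e1] at h0
    linarith
  rw [ae_restrict_iff' measurableSet_Ioo]
  filter_upwards [hkey] with x hx hx'
  linarith [hx hx']

/-- An integrable function whose weak derivative on an interval is a continuous function `k` agrees
almost everywhere with a primitive of `k`. -/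
lemma exists_hasDerivAt_of_weak_deriv {a b : ℝ} (hab : a < b) {m k : ℝ → ℝ}
    (hm : IntegrableOn m (Set.Ioo a b)) (hk : Continuous k)
    (h : ∀ ψ : ℝ → ℝ, ContDiff ℝ ∞ ψ → HasCompactSupport ψ → tsupport ψ ⊆ Set.Ioo a b →
      (∫ r in Set.Ioo a b, m r * deriv ψ r) + ∫ r in Set.Ioo a b, k r * ψ r = 0) :
    ∃ y : ℝ → ℝ, (∀ r, HasDerivAt y (k r) r) ∧
      ∀ᵐ r ∂(volume.restrict (Set.Ioo a b)), m r = y r := by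
  have hd : ∀ r, HasDerivAt (fun r => ∫ t in a..r, k t) (k r) r := fun r =>
    intervalIntegral.integral_hasDerivAt_right (hk.intervalIntegrable _ _)
      (hk.stronglyMeasurableAtFilter _ _) hk.continuousAt
  have hKc : Continuous fun r => ∫ t in a..r, k t :=
    continuous_iff_continuousAt.2 fun r => (hd r).continuousAt
  have hKi : IntegrableOn (fun r => ∫ t in a..r, k t) (Set.Ioo a b) :=
    (hKc.integrableOn_Icc (a := a) (b := b)).mono_set Set.Ioo_subset_Icc_self
  -- Integration by parts shows that `m` minus the primitive of `k` has zero weak derivative.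
  obtain ⟨c, hc⟩ := exists_ae_eq_const_of_integral_mul_deriv hab (hm.sub hKi)
    fun ψ hψ hψc hψs => by
      have hψd : Continuous (deriv ψ) := hψ.continuous_deriv (by simp)
      obtain ⟨C, hC⟩ := hψc.deriv.exists_bound_of_continuous hψd
      have i1 : IntegrableOn (fun r => m r * deriv ψ r) (Set.Ioo a b) :=
        hm.mul_bdd hψd.aestronglyMeasurable (ae_of_all _ hC)
      have i2 : IntegrableOn (fun r => (∫ t in a..r, k t) * deriv ψ r) (Set.Ioo a b) :=
        hKi.mul_bdd hψd.aestronglyMeasurable (ae_of_all _ hC)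
      have hz : ∀ x, x ∉ Set.Ioo a b → ψ x = 0 := fun x hx =>
        image_eq_zero_of_notMem_tsupport fun h' => hx (hψs h')
      have hparts := intervalIntegral.integral_mul_deriv_eq_deriv_mul (a := a) (b := b)
        (u := fun r => ∫ t in a..r, k t) (v := ψ) (u' := k) (v' := deriv ψ)
        (fun x _ => hd x) (fun x _ => (hψ.differentiable (by simp) x).hasDerivAt)
        (hk.intervalIntegrable _ _) (hψd.intervalIntegrable _ _)
      rw [hz a (by simp), hz b (by simp), mul_zero, mul_zero, sub_zero, zero_sub] at hparts
      simp_rw [intervalIntegral.integral_of_le hab.le (μ := volume), integral_Ioc_eq_integral_Ioo]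
        at hparts
      have e : ∫ r in Set.Ioo a b, (m r - ∫ t in a..r, k t) * deriv ψ r
          = (∫ r in Set.Ioo a b, m r * deriv ψ r)
            - ∫ r in Set.Ioo a b, (∫ t in a..r, k t) * deriv ψ r := by
        rw [← integral_sub i1 i2]
        congr 1; ext r; ring
      simp only [Pi.sub_apply]
      rw [e, hparts]
      linarith [h ψ hψ hψc hψs]
  refine ⟨fun r => c + ∫ t in a..r, k t, fun r => (hd r).const_add c, ?_⟩
  filter_upwards [hc] with r hr
  simp only [Pi.sub_apply] at hr
  linarith

/-- A weak solution of the radial equation which is the primitive of an integrable function is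
a classical radial profile. -/
lemma exists_isRadialProfile_of_weak {n : ℕ} {p l : ℝ} (hp : 2 < p) {w G : ℝ → ℝ}
    (hG : Integrable G) (hw : ∀ r, w r = ∫ t in (1 : ℝ)..r, G t) (hw2 : w 2 = 0)
    (hpos : ∀ᵐ r ∂(volume.restrict (Set.Ioo (1 : ℝ) 2)), 0 < w r)
    (h : ∀ ψ : ℝ → ℝ, ContDiff ℝ ∞ ψ → HasCompactSupport ψ → tsupport ψ ⊆ Set.Ioo 1 2 →
      (∫ r in Set.Ioo (1 : ℝ) 2, r ^ n * G r * deriv ψ r)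
        + ∫ r in Set.Ioo (1 : ℝ) 2, r ^ n * (l * w r - |w r| ^ (p - 2) * w r) * ψ r = 0) :
    ∃ y, IsRadialProfile n p l w y := by
  have hwc : Continuous w := by
    rw [show w = fun r => ∫ t in (1 : ℝ)..r, G t from funext hw]
    exact intervalIntegral.continuous_primitive (fun a b => hG.intervalIntegrable) 1
  have hk : Continuous fun r => r ^ n * (l * w r - |w r| ^ (p - 2) * w r) :=
    (continuous_pow n).mul ((continuous_const.mul hwc).sub
      ((hwc.abs.rpow_const fun _ => Or.inr (by linarith)).mul hwc))
  have hm : IntegrableOn (fun r => r ^ n * G r) (Set.Ioo 1 2) := by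
    refine hG.integrableOn.bdd_mul (c := 2 ^ n) (continuous_pow n).aestronglyMeasurable ?_
    filter_upwards [ae_restrict_mem measurableSet_Ioo] with r hr
    rw [norm_pow, Real.norm_of_nonneg (by linarith [hr.1])]
    exact pow_le_pow_left₀ (by linarith [hr.1]) hr.2.le n
  obtain ⟨y, hy, hGy⟩ := exists_hasDerivAt_of_weak_deriv (by norm_num) hm hk h
  have hyc : Continuous y := continuous_iff_continuousAt.2 fun r => (hy r).continuousAt
  refine ⟨y, hwc.continuousOn, hyc.continuousOn, fun r hr => ?_, fun r _ => hy r,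
    by rw [hw, intervalIntegral.integral_same], hw2, hpos⟩
  -- Replacing `G` by its representative `y t / t ^ n` makes the integrand continuous, so `w`
  -- becomes differentiable at every interior point.
  have hloc : w =ᶠ[𝓝 r] fun s => ∫ t in (1 : ℝ)..s, y t / t ^ n := by
    filter_upwards [Ioo_mem_nhds hr.1 hr.2] with s hs
    rw [hw s, intervalIntegral.integral_of_le hs.1.le, intervalIntegral.integral_of_le hs.1.le,
      integral_Ioc_eq_integral_Ioo, integral_Ioc_eq_integral_Ioo]
    refine integral_congr_ae ?_
    have hsub : Set.Ioo 1 s ⊆ Set.Ioo (1 : ℝ) 2 := Set.Ioo_subset_Ioo_right hs.2.le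
    filter_upwards [ae_restrict_of_ae_restrict_of_subset hsub hGy,
      ae_restrict_mem measurableSet_Ioo] with t ht ht'
    have : t ^ n ≠ 0 := (pow_pos (by linarith [ht'.1]) n).ne'
    rw [← ht]
    field_simp
  refine HasDerivAt.congr_of_eventuallyEq ?_ hloc
  have hcont : ContinuousOn (fun t => y t / t ^ n) (Set.Ioi 0) :=
    hyc.continuousOn.div (continuousOn_pow n) fun t ht => (pow_pos ht n).ne'
  have hr0 : 0 < r := by linarith [hr.1]
  refine intervalIntegral.integral_hasDerivAt_right ?_
    (hcont.stronglyMeasurableAtFilter isOpen_Ioi r hr0)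
    (hcont.continuousAt (Ioi_mem_nhds hr0))
  refine (hcont.mono fun t ht => ?_).intervalIntegrable
  rw [Set.uIcc_of_le hr.1.le] at ht
  exact lt_of_lt_of_le one_pos ht.1

/-! ### From weak solutions on the annulus to radial profiles. -/

/-- The radial component of a vector field, in polar coordinates. -/
noncomputable def radialComponent {N : ℕ}
    (g : EuclideanSpace ℝ (Fin N) → EuclideanSpace ℝ (Fin N))
    (q : ℝ × Metric.sphere (0 : EuclideanSpace ℝ (Fin N)) 1) : ℝ :=
  inner ℝ (g (polar q)) (q.2 : EuclideanSpace ℝ (Fin N))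

lemma inner_gradient {N : ℕ} (φ : EuclideanSpace ℝ (Fin N) → ℝ) (x v : EuclideanSpace ℝ (Fin N)) :
    inner ℝ (gradient φ x) v = fderiv ℝ φ x v := by
  rw [gradient, InnerProductSpace.toDual_symm_apply]

lemma ContDiff.continuous_gradient {N : ℕ} {φ : EuclideanSpace ℝ (Fin N) → ℝ}
    (h : ContDiff ℝ ∞ φ) : Continuous (gradient φ) :=
  (InnerProductSpace.toDual ℝ (EuclideanSpace ℝ (Fin N))).symm.continuous.comp
    (h.continuous_fderiv (by simp))

lemma HasCompactSupport.gradient {N : ℕ} {φ : EuclideanSpace ℝ (Fin N) → ℝ}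
    (h : HasCompactSupport φ) : HasCompactSupport (gradient φ) :=
  (h.fderiv (𝕜 := ℝ)).comp_left (map_zero _)

lemma Continuous.radialComponent {N : ℕ}
    {g : EuclideanSpace ℝ (Fin N) → EuclideanSpace ℝ (Fin N)} (hg : Continuous g) :
    Continuous (radialComponent g) :=
  (hg.comp continuous_polar).inner (continuous_subtype_val.comp continuous_snd)

lemma abs_radialComponent_le {N : ℕ}
    (g : EuclideanSpace ℝ (Fin N) → EuclideanSpace ℝ (Fin N))
    (q : ℝ × Metric.sphere (0 : EuclideanSpace ℝ (Fin N)) 1) :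
    ‖radialComponent g q‖ ≤ ‖g (polar q)‖ := by
  have := norm_inner_le_norm (𝕜 := ℝ) (g (polar q)) (q.2 : EuclideanSpace ℝ (Fin N))
  rwa [norm_eq_of_mem_sphere q.2, mul_one] at this

lemma apply_polar_eq_integral {N : ℕ} {φ : EuclideanSpace ℝ (Fin N) → ℝ}
    (h : IsTestFunction (annulus N) φ) (r : ℝ)
    (θ : Metric.sphere (0 : EuclideanSpace ℝ (Fin N)) 1) :
    φ (polar (r, θ)) = ∫ t in (1 : ℝ)..r, radialComponent (gradient φ) (t, θ) := by
  have hc : Continuous fun t : ℝ => radialComponent (gradient φ) (t, θ) :=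
    h.contDiff.continuous_gradient.radialComponent.comp (continuous_id.prodMk continuous_const)
  have hd : ∀ t : ℝ, HasDerivAt (fun t => φ (polar (t, θ)))
      (radialComponent (gradient φ) (t, θ)) t := by
    intro t
    rw [radialComponent, inner_gradient]
    have h1 : HasDerivAt (fun t : ℝ => polar (t, θ)) (θ : EuclideanSpace ℝ (Fin N)) t := by
      simpa [polar] using (hasDerivAt_id t).smul_const (θ : EuclideanSpace ℝ (Fin N))
    exact (h.contDiff.differentiable (by simp) (polar (t, θ))).hasFDerivAt.comp_hasDerivAt t h1
  rw [intervalIntegral.integral_eq_sub_of_hasDerivAt (fun t _ => hd t)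
    (hc.intervalIntegrable _ _)]
  have : φ (polar (1, θ)) = 0 := by
    refine image_eq_zero_of_notMem_tsupport fun hmem => ?_
    have := (h.tsupport_subset hmem).1
    rw [norm_polar zero_le_one] at this
    exact lt_irrefl _ this
  rw [this, sub_zero]

lemma apply_polar_two {N : ℕ} {φ : EuclideanSpace ℝ (Fin N) → ℝ}
    (h : IsTestFunction (annulus N) φ) (θ : Metric.sphere (0 : EuclideanSpace ℝ (Fin N)) 1) :
    φ (polar (2, θ)) = 0 := by
  refine image_eq_zero_of_notMem_tsupport fun hmem => ?_
  have := (h.tsupport_subset hmem).2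
  rw [norm_polar zero_le_two] at this
  exact lt_irrefl _ this

lemma integrable_radialComponent_gradient {N : ℕ} {φ : EuclideanSpace ℝ (Fin N) → ℝ}
    (h : IsTestFunction (annulus N) φ)
    (μ : Measure (ℝ × Metric.sphere (0 : EuclideanSpace ℝ (Fin N)) 1)) [IsFiniteMeasure μ] :
    Integrable (radialComponent (gradient φ)) μ := by
  obtain ⟨C, hC⟩ := h.hasCompactSupport.gradient.exists_bound_of_continuous
    h.contDiff.continuous_gradient
  exact Integrable.of_bound h.contDiff.continuous_gradient.radialComponent.aestronglyMeasurable C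
    (ae_of_all _ fun q => (abs_radialComponent_le _ q).trans (hC _))

lemma integrable_comp_polar {N : ℕ} {φ : EuclideanSpace ℝ (Fin N) → ℝ}
    (h : IsTestFunction (annulus N) φ)
    (μ : Measure (ℝ × Metric.sphere (0 : EuclideanSpace ℝ (Fin N)) 1)) [IsFiniteMeasure μ] :
    Integrable (fun q => φ (polar q)) μ := by
  obtain ⟨C, hC⟩ := h.hasCompactSupport.exists_bound_of_continuous h.contDiff.continuous
  exact Integrable.of_bound (h.contDiff.continuous.comp continuous_polar).aestronglyMeasurable C
    (ae_of_all _ fun q => hC _)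

/-- The spherical integral of a test function is the primitive of the spherical integral of its
radial derivative. -/
lemma integral_sphere_eq_integral {N : ℕ} {φ : EuclideanSpace ℝ (Fin N) → ℝ}
    (h : IsTestFunction (annulus N) φ) {r : ℝ} (hr : 1 ≤ r) :
    ∫ θ, φ (polar (r, θ)) ∂(sphereMeasure N)
      = ∫ t in (1 : ℝ)..r, ∫ θ, radialComponent (gradient φ) (t, θ) ∂(sphereMeasure N) := by
  simp_rw [apply_polar_eq_integral h r, intervalIntegral.integral_of_le hr]
  exact (integral_integral_swap (f := fun t θ => radialComponent (gradient φ) (t, θ))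
    (integrable_radialComponent_gradient h _)).symm

/-- Convergence in `L²` on a space of finite measure implies convergence in `L¹`. -/
lemma tendsto_lintegral_enorm_of_eLpNorm_two {α F : Type*} [MeasurableSpace α]
    [NormedAddCommGroup F] {μ : Measure α} [IsFiniteMeasure μ] {f : ℕ → α → F}
    (hf : ∀ n, AEStronglyMeasurable (f n) μ)
    (h : Tendsto (fun n => eLpNorm (f n) 2 μ) atTop (𝓝 0)) :
    Tendsto (fun n => ∫⁻ x, ‖f n x‖ₑ ∂μ) atTop (𝓝 0) := by
  have hle : ∀ n, ∫⁻ x, ‖f n x‖ₑ ∂μ ≤ eLpNorm (f n) 2 μ * μ Set.univ ^ ((1 : ℝ) / 2) := by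
    intro n
    rw [← eLpNorm_one_eq_lintegral_enorm]
    refine (eLpNorm_le_eLpNorm_mul_rpow_measure_univ one_le_two (hf n)).trans_eq ?_
    norm_num
  refine tendsto_of_tendsto_of_tendsto_of_le_of_le tendsto_const_nhds ?_ (fun _ => zero_le) hle
  have hfin : μ Set.univ ^ ((1 : ℝ) / 2) ≠ ⊤ :=
    ENNReal.rpow_ne_top_of_nonneg (by norm_num) (measure_ne_top _ _)
  simpa using ENNReal.Tendsto.mul_const h (Or.inr hfin)

/-- Integrating out a variable is continuous in `L¹`. -/
lemma tendsto_lintegral_enorm_integral_sub {α β : Type*} [MeasurableSpace α] [MeasurableSpace β]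
    {μ : Measure α} {ν : Measure β} [SFinite μ] [SFinite ν] {f : ℕ → α × β → ℝ} {g : α × β → ℝ}
    (hf : ∀ n, Integrable (f n) (μ.prod ν)) (hg : Integrable g (μ.prod ν))
    (h : Tendsto (fun n => ∫⁻ q, ‖f n q - g q‖ₑ ∂(μ.prod ν)) atTop (𝓝 0)) :
    Tendsto (fun n => ∫⁻ x, ‖(∫ z, f n (x, z) ∂ν) - ∫ z, g (x, z) ∂ν‖ₑ ∂μ) atTop (𝓝 0) := by
  refine tendsto_of_tendsto_of_tendsto_of_le_of_le tendsto_const_nhds h (fun _ => zero_le)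
    fun n => ?_
  have hm : AEMeasurable (fun q => ‖f n q - g q‖ₑ) (μ.prod ν) :=
    ((hf n).sub hg).aestronglyMeasurable.enorm
  rw [lintegral_prod _ hm]
  refine lintegral_mono_ae ?_
  filter_upwards [(hf n).prod_right_ae, hg.prod_right_ae] with x h1 h2
  rw [← integral_sub h1 h2]
  exact enorm_integral_le_lintegral_enorm _

/-- If `Φ n` is the primitive of `Γ n`, vanishing at both ends of an interval, and if `Φ n → U`
and `Γ n → Γ` in `L¹`, then `U` is the primitive of `Γ` and vanishes at both ends. -/
lemma ae_eq_integral_of_tendsto {a b : ℝ} (hab : a ≤ b) {Φ Γn : ℕ → ℝ → ℝ} {U Γ : ℝ → ℝ}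
    (hΓn : ∀ n, IntegrableOn (Γn n) (Set.Ioo a b)) (hΓ : IntegrableOn Γ (Set.Ioo a b))
    (hU : IntegrableOn U (Set.Ioo a b))
    (hΦ : ∀ n, ∀ r ∈ Set.Icc a b, Φ n r = ∫ t in a..r, Γn n t) (hΦb : ∀ n, Φ n b = 0)
    (h1 : Tendsto (fun n => ∫⁻ r in Set.Ioo a b, ‖Φ n r - U r‖ₑ) atTop (𝓝 0))
    (h2 : Tendsto (fun n => ∫⁻ r in Set.Ioo a b, ‖Γn n r - Γ r‖ₑ) atTop (𝓝 0)) :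
    (∀ᵐ r ∂(volume.restrict (Set.Ioo a b)), U r = ∫ t in a..r, Γ t) ∧
      ∫ t in a..b, Γ t = 0 := by
  -- `L¹` convergence of the derivatives gives uniform convergence of the primitives, including at
  -- `b`; this carries the boundary value to the limit.
  have hunif : ∀ n, ∀ r ∈ Set.Icc a b,
      ‖Φ n r - ∫ t in a..r, Γ t‖ₑ ≤ ∫⁻ r in Set.Ioo a b, ‖Γn n r - Γ r‖ₑ := by
    intro n r hr
    have hsub : Set.Ioo a r ⊆ Set.Ioo a b := Set.Ioo_subset_Ioo_right hr.2
    rw [hΦ n r hr, intervalIntegral.integral_of_le hr.1, intervalIntegral.integral_of_le hr.1,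
      integral_Ioc_eq_integral_Ioo, integral_Ioc_eq_integral_Ioo,
      ← integral_sub ((hΓn n).mono_set hsub) (hΓ.mono_set hsub)]
    exact (enorm_integral_le_lintegral_enorm _).trans
      (lintegral_mono' (Measure.restrict_mono hsub le_rfl) le_rfl)
  have hWc : ContinuousOn (fun r => ∫ t in a..r, Γ t) (Set.Icc a b) :=
    intervalIntegral.continuousOn_primitive_interval
      (by rw [Set.uIcc_of_le hab]; exact (integrableOn_Icc_iff_integrableOn_Ioo).2 hΓ) |>.mono
      (by rw [Set.uIcc_of_le hab])
  have hWm : AEStronglyMeasurable (fun r => ∫ t in a..r, Γ t) (volume.restrict (Set.Ioo a b)) :=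
    (hWc.mono Set.Ioo_subset_Icc_self).aestronglyMeasurable measurableSet_Ioo
  constructor
  · have hzero : ∫⁻ r in Set.Ioo a b, ‖U r - ∫ t in a..r, Γ t‖ₑ = 0 := by
      refine le_antisymm ?_ zero_le
      have hle : ∀ n, ∫⁻ r in Set.Ioo a b, ‖U r - ∫ t in a..r, Γ t‖ₑ
          ≤ (∫⁻ r in Set.Ioo a b, ‖Φ n r - U r‖ₑ)
            + (∫⁻ r in Set.Ioo a b, ‖Γn n r - Γ r‖ₑ) * volume (Set.Ioo a b) := by
        intro n
        calc ∫⁻ r in Set.Ioo a b, ‖U r - ∫ t in a..r, Γ t‖ₑ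
            ≤ ∫⁻ r in Set.Ioo a b, (‖Φ n r - U r‖ₑ
                + ∫⁻ r in Set.Ioo a b, ‖Γn n r - Γ r‖ₑ) := by
              refine setLIntegral_mono_ae' measurableSet_Ioo (ae_of_all _ fun r hr => ?_)
              have e : U r - ∫ t in a..r, Γ t = -(Φ n r - U r) + (Φ n r - ∫ t in a..r, Γ t) := by
                ring
              rw [e]
              refine (enorm_add_le _ _).trans ?_
              rw [enorm_neg]
              exact add_le_add le_rfl (hunif n r (Set.Ioo_subset_Icc_self hr))
          _ = _ := by
              rw [lintegral_add_right _ measurable_const, lintegral_const,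
                Measure.restrict_apply_univ]
      have hlim : Tendsto (fun n => (∫⁻ r in Set.Ioo a b, ‖Φ n r - U r‖ₑ)
          + (∫⁻ r in Set.Ioo a b, ‖Γn n r - Γ r‖ₑ) * volume (Set.Ioo a b)) atTop (𝓝 0) := by
        simpa using h1.add (ENNReal.Tendsto.mul_const h2
          (Or.inr (measure_Ioo_lt_top (a := a) (b := b) (μ := volume)).ne))
      exact ge_of_tendsto' hlim hle
    have hm : AEMeasurable (fun r => ‖U r - ∫ t in a..r, Γ t‖ₑ)
        (volume.restrict (Set.Ioo a b)) := (hU.aestronglyMeasurable.sub hWm).enorm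
    rw [lintegral_eq_zero_iff' hm] at hzero
    filter_upwards [hzero] with r hr
    simpa [sub_eq_zero] using hr
  · have hb : ∀ n, ‖∫ t in a..b, Γ t‖ₑ ≤ ∫⁻ r in Set.Ioo a b, ‖Γn n r - Γ r‖ₑ := by
      intro n
      have := hunif n b (Set.right_mem_Icc.2 hab)
      rwa [hΦb n, zero_sub, enorm_neg] at this
    have : ‖∫ t in a..b, Γ t‖ₑ ≤ 0 := ge_of_tendsto' h2 hb
    simpa using this

/-- A radial smooth function is a test function on the annulus. -/
lemma isTestFunction_comp_norm {N : ℕ} {ψ : ℝ → ℝ} (hψ : ContDiff ℝ ∞ ψ)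
    (hs : tsupport ψ ⊆ Set.Ioo 1 2) :
    IsTestFunction (annulus N) fun x => ψ ‖x‖ := by
  have hsupp : tsupport (fun x : EuclideanSpace ℝ (Fin N) => ψ ‖x‖) ⊆ annulus N := by
    have h1 : tsupport (fun x : EuclideanSpace ℝ (Fin N) => ψ ‖x‖) ⊆ norm ⁻¹' tsupport ψ :=
      closure_minimal (fun x hx => subset_tsupport ψ hx)
        ((isClosed_tsupport ψ).preimage continuous_norm)
    exact fun x hx => hs (h1 hx)
  refine ⟨contDiff_iff_contDiffAt.2 fun x => ?_, ?_, hsupp⟩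
  · rcases eq_or_ne x 0 with rfl | hx
    · have hz : (fun x : EuclideanSpace ℝ (Fin N) => ψ ‖x‖) =ᶠ[𝓝 0] fun _ => 0 := by
        filter_upwards [Metric.ball_mem_nhds (0 : EuclideanSpace ℝ (Fin N)) one_pos] with x hx
        refine image_eq_zero_of_notMem_tsupport fun h => ?_
        rw [mem_ball_zero_iff] at hx
        exact absurd (hs h).1 hx.not_gt
      exact contDiffAt_const.congr_of_eventuallyEq hz
    · exact hψ.contDiffAt.comp x (contDiffAt_norm ℝ hx)
  · refine HasCompactSupport.of_support_subset_isCompact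
      (isCompact_closedBall (0 : EuclideanSpace ℝ (Fin N)) 2) fun x hx => ?_
    rw [mem_closedBall_zero_iff]
    exact (hsupp (subset_tsupport _ hx)).2.le

/-- The derivative of a radial function along a vector field only sees the radial component. -/
lemma inner_gradient_comp_norm {N : ℕ} {ψ : ℝ → ℝ} (hψ : ContDiff ℝ ∞ ψ)
    (g : EuclideanSpace ℝ (Fin N) → EuclideanSpace ℝ (Fin N)) {r : ℝ} (hr : 0 < r)
    (θ : Metric.sphere (0 : EuclideanSpace ℝ (Fin N)) 1) :
    inner ℝ (g (polar (r, θ))) (gradient (fun x => ψ ‖x‖) (polar (r, θ)))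
      = deriv ψ r * radialComponent g (r, θ) := by
  have hn := norm_polar hr.le θ
  have hx : polar (r, θ) ≠ 0 := by rw [← norm_pos_iff, hn]; exact hr
  have h1 : HasFDerivAt (fun x : EuclideanSpace ℝ (Fin N) => ‖x‖)
      ((1 / (2 * √(‖polar (r, θ)‖ ^ 2))) • (2 • innerSL ℝ (polar (r, θ)))) (polar (r, θ)) := by
    have h2 := (hasStrictFDerivAt_norm_sq (polar (r, θ))).hasFDerivAt.sqrt
      (by positivity)
    simpa only [Real.sqrt_sq (norm_nonneg _)] using h2
  have h3 := ((hψ.differentiable (by simp) ‖polar (r, θ)‖).hasDerivAt.comp_hasFDerivAt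
    (polar (r, θ)) h1).fderiv
  rw [real_inner_comm, inner_gradient]
  change fderiv ℝ (ψ ∘ fun x => ‖x‖) (polar (r, θ)) (g (polar (r, θ))) = _
  rw [h3, hn, Real.sqrt_sq hr.le, radialComponent, real_inner_comm]
  simp only [polar, _root_.smul_apply, innerSL_apply_apply, inner_smul_left, smul_eq_mul,
    nsmul_eq_mul, conj_trivial]
  push_cast
  field_simp

lemma sphereMeasure_real_univ_pos {N : ℕ} (hN : 1 ≤ N) :
    0 < (sphereMeasure N).real Set.univ := by
  have : Nonempty (Fin N) := ⟨⟨0, hN⟩⟩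
  exact ENNReal.toReal_pos (Measure.measure_univ_ne_zero.2 (Measure.toSphere_ne_zero _))
    (measure_ne_top _ _)

lemma integral_annulus_eq {N : ℕ} {F : EuclideanSpace ℝ (Fin N) → ℝ}
    (hF : AEStronglyMeasurable F (volume.restrict (annulus N))) :
    ∫ x in annulus N, F x
      = ∫ q, F (polar q) ∂((radialMeasure (N - 1)).prod (sphereMeasure N)) := by
  rw [← (measurePreserving_polar N).map_eq] at hF ⊢
  exact integral_map (measurePreserving_polar N).measurable.aemeasurable hF

lemma ae_fst_mem_Ioo (N : ℕ) :
    ∀ᵐ q ∂((radialMeasure (N - 1)).prod (sphereMeasure N)), q.1 ∈ Set.Ioo (1 : ℝ) 2 :=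
  Measure.quasiMeasurePreserving_fst.ae
    ((radialMeasure_absolutelyContinuous (N - 1)).ae_le (ae_restrict_mem measurableSet_Ioo))

lemma tendsto_lintegral_enorm_comp_polar {N : ℕ} {F : Type*} [NormedAddCommGroup F]
    {f : ℕ → EuclideanSpace ℝ (Fin N) → F}
    (hf : ∀ n, AEStronglyMeasurable (f n) (volume.restrict (annulus N)))
    (h : Tendsto (fun n => eLpNorm (f n) 2 (volume.restrict (annulus N))) atTop (𝓝 0)) :
    Tendsto (fun n => ∫⁻ q, ‖f n (polar q)‖ₑ
      ∂((radialMeasure (N - 1)).prod (sphereMeasure N))) atTop (𝓝 0) := by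
  have hP := measurePreserving_polar N
  refine tendsto_lintegral_enorm_of_eLpNorm_two
    (fun n => (hf n).comp_quasiMeasurePreserving hP.quasiMeasurePreserving) ?_
  have e : ∀ n, eLpNorm (fun q => f n (polar q)) 2
      ((radialMeasure (N - 1)).prod (sphereMeasure N))
      = eLpNorm (f n) 2 (volume.restrict (annulus N)) :=
    fun n => eLpNorm_comp_measurePreserving (hf n) hP
  simpa only [e] using h

/-- The radial representative of an `H¹₀` function on the annulus whose values only depend on `|x|`
is the primitive of the mean of the radial component of its weak gradient, and it vanishes at
both ends. -/
lemma IsH10.exists_radial_primitive {N : ℕ} (hN : 1 ≤ N) {u : EuclideanSpace ℝ (Fin N) → ℝ}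
    {g : EuclideanSpace ℝ (Fin N) → EuclideanSpace ℝ (Fin N)} (h : IsH10 (annulus N) u g)
    (hrad : ∃ f : ℝ → ℝ, ∀ᵐ x ∂(volume.restrict (annulus N)), u x = f ‖x‖) :
    ∃ w G : ℝ → ℝ, Integrable G ∧ (∀ r, w r = ∫ t in (1 : ℝ)..r, G t) ∧ w 2 = 0 ∧
      (∀ᵐ q ∂((radialMeasure (N - 1)).prod (sphereMeasure N)), u (polar q) = w q.1) ∧
      Integrable (radialComponent g) ((radialMeasure (N - 1)).prod (sphereMeasure N)) ∧
      ∀ r ∈ Set.Ioo (1 : ℝ) 2, ∫ θ, radialComponent g (r, θ) ∂(sphereMeasure N)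
        = (sphereMeasure N).real Set.univ * G r := by
  have hS := sphereMeasure_real_univ_pos hN
  have hP := measurePreserving_polar N
  set μ := (radialMeasure (N - 1)).prod (sphereMeasure N) with hμ
  obtain ⟨φ, hφ, hφu, hφg⟩ := h.approx
  have humeas := h.isH1.memLp.aestronglyMeasurable
  have hgmeas := h.isH1.memLp_grad.aestronglyMeasurable
  have huP : Integrable (fun q => u (polar q)) μ :=
    (h.isH1.memLp.comp_measurePreserving hP).integrable one_le_two
  have hgP : Integrable (fun q => g (polar q)) μ :=
    (h.isH1.memLp_grad.comp_measurePreserving hP).integrable one_le_two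
  have hγ : Integrable (radialComponent g) μ := by
    refine hgP.norm.mono' ?_ (ae_of_all _ fun q => abs_radialComponent_le g q)
    exact hgP.aestronglyMeasurable.inner
      (continuous_subtype_val.comp continuous_snd).aestronglyMeasurable
  have hdu := tendsto_lintegral_enorm_comp_polar
    (fun n => (hφ n).contDiff.continuous.aestronglyMeasurable.sub humeas) hφu
  have hdg := tendsto_lintegral_enorm_comp_polar
    (fun n => (hφ n).contDiff.continuous_gradient.aestronglyMeasurable.sub hgmeas) hφg
  have hdγ : Tendsto (fun n => ∫⁻ q, ‖radialComponent (gradient (φ n)) q - radialComponent g q‖ₑ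
      ∂μ) atTop (𝓝 0) := by
    refine tendsto_of_tendsto_of_tendsto_of_le_of_le tendsto_const_nhds hdg (fun _ => zero_le)
      fun n => lintegral_mono fun q => ?_
    have e : radialComponent (gradient (φ n)) q - radialComponent g q
        = radialComponent (fun x => gradient (φ n) x - g x) q := by
      simp only [radialComponent, inner_sub_left]
    rw [e]
    exact enorm_le_iff_norm_le.2 (abs_radialComponent_le _ q)
  have hle := restrict_le_radialMeasure (N - 1)
  have t1 := tendsto_lintegral_enorm_integral_sub
    (fun n => integrable_comp_polar (hφ n) μ) huP hdu
  have t2 := tendsto_lintegral_enorm_integral_sub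
    (fun n => integrable_radialComponent_gradient (hφ n) μ) hγ hdγ
  have t1' := tendsto_of_tendsto_of_tendsto_of_le_of_le tendsto_const_nhds t1
    (fun _ => zero_le) fun n => lintegral_mono' hle le_rfl
  have t2' := tendsto_of_tendsto_of_tendsto_of_le_of_le tendsto_const_nhds t2
    (fun _ => zero_le) fun n => lintegral_mono' hle le_rfl
  have hΓ : IntegrableOn (fun r => ∫ θ, radialComponent g (r, θ) ∂(sphereMeasure N))
      (Set.Ioo 1 2) := hγ.integral_prod_left.mono_measure hle
  obtain ⟨hae, hzero⟩ := ae_eq_integral_of_tendsto one_le_two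
    (fun n => (integrable_radialComponent_gradient (hφ n) μ).integral_prod_left.mono_measure hle)
    hΓ (huP.integral_prod_left.mono_measure hle)
    (fun n r hr => integral_sphere_eq_integral (hφ n) hr.1)
    (fun n => by simp [apply_polar_two (hφ n)]) t1' t2'
  set S := (sphereMeasure N).real Set.univ
  set Γ : ℝ → ℝ := fun r => ∫ θ, radialComponent g (r, θ) ∂(sphereMeasure N)
  -- Dividing by the area of the sphere gives the mean; cutting off makes it integrable on the whole
  -- line, so its primitive is continuous everywhere.
  set G : ℝ → ℝ := (Set.Ioo 1 2).indicator fun r => S⁻¹ * Γ r with hG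
  have hprim : ∀ r ∈ Set.Icc (1 : ℝ) 2, ∫ t in (1 : ℝ)..r, G t = S⁻¹ * ∫ t in (1 : ℝ)..r, Γ t := by
    intro r hr
    rw [← intervalIntegral.integral_const_mul, intervalIntegral.integral_of_le hr.1,
      intervalIntegral.integral_of_le hr.1, integral_Ioc_eq_integral_Ioo,
      integral_Ioc_eq_integral_Ioo]
    refine setIntegral_congr_fun measurableSet_Ioo fun t ht => ?_
    exact Set.indicator_of_mem (s := Set.Ioo (1 : ℝ) 2) (f := fun r => S⁻¹ * Γ r)
      ⟨ht.1, ht.2.trans_le hr.2⟩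
  refine ⟨fun r => ∫ t in (1 : ℝ)..r, G t, G, (integrable_indicator_iff
    measurableSet_Ioo).2 (hΓ.const_mul S⁻¹), fun _ => rfl, ?_, ?_, hγ, fun r hr => ?_⟩
  · simp only
    rw [hprim 2 (by norm_num), hzero, mul_zero]
  · obtain ⟨f, hf⟩ := hrad
    have hfP : ∀ᵐ q ∂μ, u (polar q) = f q.1 := by
      filter_upwards [hP.quasiMeasurePreserving.ae hf, ae_fst_mem_Ioo N] with q hq hq1
      rw [hq, norm_polar (by linarith [hq1.1])]
    have hfw : ∀ᵐ r ∂(radialMeasure (N - 1)), f r = ∫ t in (1 : ℝ)..r, G t := by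
      filter_upwards [Measure.ae_ae_of_ae_prod hfP,
        (radialMeasure_absolutelyContinuous (N - 1)).ae_le hae,
        (radialMeasure_absolutelyContinuous (N - 1)).ae_le (ae_restrict_mem measurableSet_Ioo)]
        with r h1 h2 h3
      rw [hprim r (Set.Ioo_subset_Icc_self h3), ← h2, integral_congr_ae h1, integral_const,
        smul_eq_mul, ← mul_assoc, inv_mul_cancel₀ hS.ne', one_mul]
    filter_upwards [hfP, Measure.quasiMeasurePreserving_fst.ae hfw] with q h1 h2
    rw [h1, h2]
  · rw [hG, Set.indicator_of_mem hr, ← mul_assoc, mul_inv_cancel₀ hS.ne', one_mul]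

/-- A positive radial weak solution is represented by a classical radial profile. -/
theorem IsPositiveRadialSolution.exists_isRadialProfile {N : ℕ} (hN : 1 ≤ N) {p l : ℝ}
    (hp : 2 < p) {u : EuclideanSpace ℝ (Fin N) → ℝ} (h : IsPositiveRadialSolution N p l u) :
    ∃ w y, IsRadialProfile (N - 1) p l w y ∧
      ∫ x in annulus N, u x ^ 2
        = (sphereMeasure N).real Set.univ * ∫ r in (1 : ℝ)..2, r ^ (N - 1) * w r ^ 2 := by
  have : Nonempty (Fin N) := ⟨⟨0, hN⟩⟩
  have : NeZero (sphereMeasure N) := ⟨Measure.toSphere_ne_zero _⟩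
  have hS := sphereMeasure_real_univ_pos hN
  have hP := measurePreserving_polar N
  obtain ⟨g, hH, hweak⟩ := h.weak_solution
  obtain ⟨w, G, hG, hwG, hw2, huw, hγ, hGγ⟩ := hH.exists_radial_primitive hN h.radial
  have humeas := hH.isH1.memLp.aestronglyMeasurable
  have hgmeas := hH.isH1.memLp_grad.aestronglyMeasurable
  have hradint : ∀ F : ℝ → ℝ, ∫ q, F q.1 ∂((radialMeasure (N - 1)).prod (sphereMeasure N))
      = (sphereMeasure N).real Set.univ * ∫ r in Set.Ioo (1 : ℝ) 2, r ^ (N - 1) * F r := by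
    intro F
    rw [integral_fun_fst, smul_eq_mul, integral_radialMeasure]
  have hpos : ∀ᵐ r ∂(volume.restrict (Set.Ioo (1 : ℝ) 2)), 0 < w r := by
    refine Measure.absolutelyContinuous_of_le (restrict_le_radialMeasure (N - 1)) |>.ae_le ?_
    have : ∀ᵐ q ∂((radialMeasure (N - 1)).prod (sphereMeasure N)), 0 < w q.1 := by
      filter_upwards [hP.quasiMeasurePreserving.ae h.pos, huw] with q h1 h2
      rwa [← h2]
    filter_upwards [Measure.ae_ae_of_ae_prod this] with r hr
    -- The property does not involve the angle, and the sphere has positive measure.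
    exact hr.exists.choose_spec
  obtain ⟨y, hy⟩ := exists_isRadialProfile_of_weak (n := N - 1) (l := l) hp hG hwG hw2 hpos
    fun ψ hψ hψc hψs => by
      have htest := isTestFunction_comp_norm (N := N) hψ hψs
      have hcφ : Continuous fun x : EuclideanSpace ℝ (Fin N) => ψ ‖x‖ := htest.contDiff.continuous
      have key := hweak _ htest
      obtain ⟨C, hC⟩ := hψc.deriv.exists_bound_of_continuous (hψ.continuous_deriv (by simp))
      have hγψ : Integrable (fun q => deriv ψ q.1 * radialComponent g q)
          ((radialMeasure (N - 1)).prod (sphereMeasure N)) :=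
        hγ.bdd_mul ((hψ.continuous_deriv (by simp)).comp continuous_fst).aestronglyMeasurable
          (ae_of_all _ fun q => hC q.1)
      have e1 : ∫ x in annulus N, inner ℝ (g x) (gradient (fun x => ψ ‖x‖) x)
          = (sphereMeasure N).real Set.univ
            * ∫ r in Set.Ioo (1 : ℝ) 2, r ^ (N - 1) * G r * deriv ψ r := by
        rw [integral_annulus_eq
          (hgmeas.inner htest.contDiff.continuous_gradient.aestronglyMeasurable)]
        have : ∫ q, inner ℝ (g (polar q)) (gradient (fun x => ψ ‖x‖) (polar q))
              ∂((radialMeasure (N - 1)).prod (sphereMeasure N))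
            = ∫ q, deriv ψ q.1 * radialComponent g q
              ∂((radialMeasure (N - 1)).prod (sphereMeasure N)) := by
          refine integral_congr_ae ?_
          filter_upwards [ae_fst_mem_Ioo N] with q hq
          exact inner_gradient_comp_norm hψ g (by linarith [hq.1]) q.2
        rw [this, integral_prod _ hγψ, integral_radialMeasure, ← integral_const_mul]
        refine setIntegral_congr_fun measurableSet_Ioo fun r hr => ?_
        simp only
        rw [integral_const_mul, hGγ r hr]
        ring
      have e2 : ∫ x in annulus N, u x * ψ ‖x‖
          = (sphereMeasure N).real Set.univ
            * ∫ r in Set.Ioo (1 : ℝ) 2, r ^ (N - 1) * (w r * ψ r) := by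
        rw [integral_annulus_eq (F := fun x => u x * ψ ‖x‖) (humeas.mul hcφ.aestronglyMeasurable),
          ← hradint fun r => w r * ψ r]
        refine integral_congr_ae ?_
        filter_upwards [ae_fst_mem_Ioo N, huw] with q hq hq'
        rw [hq', norm_polar (by linarith [hq.1])]
      have e3 : ∫ x in annulus N, |u x| ^ (p - 2) * u x * ψ ‖x‖
          = (sphereMeasure N).real Set.univ
            * ∫ r in Set.Ioo (1 : ℝ) 2, r ^ (N - 1) * (|w r| ^ (p - 2) * w r * ψ r) := by
        have hm : AEStronglyMeasurable (fun x => |u x| ^ (p - 2))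
            (volume.restrict (annulus N)) :=
          (humeas.norm.aemeasurable.pow_const (p - 2)).aestronglyMeasurable
        rw [integral_annulus_eq (F := fun x => |u x| ^ (p - 2) * u x * ψ ‖x‖)
            ((hm.mul humeas).mul hcφ.aestronglyMeasurable),
          ← hradint fun r => |w r| ^ (p - 2) * w r * ψ r]
        refine integral_congr_ae ?_
        filter_upwards [ae_fst_mem_Ioo N, huw] with q hq hq'
        rw [hq', norm_polar (by linarith [hq.1])]
      rw [e1, e2, e3] at key
      have hwc : Continuous w := by
        rw [show w = fun r => ∫ t in (1 : ℝ)..r, G t from funext hwG]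
        exact intervalIntegral.continuous_primitive (fun a b => hG.intervalIntegrable) 1
      have hint : ∀ F : ℝ → ℝ, Continuous F → IntegrableOn F (Set.Ioo 1 2) := fun F hF =>
        (hF.integrableOn_Icc (a := 1) (b := 2)).mono_set Set.Ioo_subset_Icc_self
      have i2 := hint (fun r => r ^ (N - 1) * (w r * ψ r))
        ((continuous_pow _).mul (hwc.mul hψ.continuous))
      have i3 := hint (fun r => r ^ (N - 1) * (|w r| ^ (p - 2) * w r * ψ r))
        ((continuous_pow _).mul (((hwc.abs.rpow_const fun _ => Or.inr (by linarith)).mul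
          hwc).mul hψ.continuous))
      have e4 : ∫ r in Set.Ioo (1 : ℝ) 2,
            r ^ (N - 1) * (l * w r - |w r| ^ (p - 2) * w r) * ψ r
          = l * (∫ r in Set.Ioo (1 : ℝ) 2, r ^ (N - 1) * (w r * ψ r))
            - ∫ r in Set.Ioo (1 : ℝ) 2, r ^ (N - 1) * (|w r| ^ (p - 2) * w r * ψ r) := by
        rw [← integral_const_mul, ← integral_sub (i2.const_mul l) i3]
        congr 1; ext r; ring
      rw [e4]
      -- All terms carry the area of the sphere as a common factor.
      refine mul_left_cancel₀ hS.ne' ?_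
      linarith
  refine ⟨w, y, hy, ?_⟩
  rw [integral_annulus_eq (F := fun x => u x ^ 2) (humeas.pow 2), intervalIntegral.integral_of_le one_le_two,
    integral_Ioc_eq_integral_Ioo, ← hradint fun r => w r ^ 2]
  refine integral_congr_ae ?_
  filter_upwards [huw] with q hq
  rw [hq]

/-! ### Mass bounds for solutions and the three regimes. -/

lemma IsPositiveRadialSolution.le_integral_sq {N : ℕ} (hN : 1 ≤ N) {p l : ℝ}
    (hp : 2 < p) (hp6 : p ≤ 6) (hl : 0 < l) {u : EuclideanSpace ℝ (Fin N) → ℝ}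
    (h : IsPositiveRadialSolution N p l u) :
    (sphereMeasure N).real Set.univ * (l ^ ((6 - p) / (2 * (p - 2))) / 2)
      ≤ ∫ x in annulus N, u x ^ 2 := by
  obtain ⟨w, y, hw, he⟩ := h.exists_isRadialProfile hN hp
  rw [he]
  exact mul_le_mul_of_nonneg_left (hw.rpow_le_integral hp hp6 hl) measureReal_nonneg

lemma IsPositiveRadialSolution.integral_sq_le {p l : ℝ} (hp : 6 ≤ p) (hl : 0 < l)
    {u : EuclideanSpace ℝ (Fin 2) → ℝ} (h : IsPositiveRadialSolution 2 p l u) :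
    ∫ x in annulus 2, u x ^ 2 ≤ (sphereMeasure 2).real Set.univ *
      (2 * ((4 * √(6 * p) + √(p / 2)) * ((l * p / 4) ^ (1 / (p - 2))) ^ (3 - p / 2))) := by
  obtain ⟨w, y, hw, he⟩ := h.exists_isRadialProfile one_le_two (by linarith : 2 < p)
  have hlp : 0 < l * p / 4 := by positivity
  have hθ : ((l * p / 4) ^ (1 / (p - 2))) ^ (p - 2) = l * p / 4 := by
    rw [← Real.rpow_mul hlp.le, one_div, inv_mul_cancel₀ (by linarith), Real.rpow_one]
  have hmain := hw.integral_sq_le hp hl (Real.rpow_pos_of_pos hlp _) hθ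
  rw [he]
  refine mul_le_mul_of_nonneg_left (le_trans ?_ (mul_le_mul_of_nonneg_left hmain zero_le_two))
    measureReal_nonneg
  -- The planar weight satisfies `r ≤ 2`, whence the factor `2` in the bound.
  rw [← intervalIntegral.integral_const_mul]
  have c : ContinuousOn (fun r => w r ^ 2) (Set.Icc 1 2) := hw.continuousOn.pow 2
  refine intervalIntegral.integral_mono_on one_le_two
    (hw.continuousOn_pow_mul_sq.intervalIntegrable_of_Icc one_le_two)
    ((c.intervalIntegrable_of_Icc one_le_two).const_mul 2) fun r hr => ?_
  change r ^ 1 * w r ^ 2 ≤ 2 * w r ^ 2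
  rw [pow_one]
  exact mul_le_mul_of_nonneg_right hr.2 (sq_nonneg _)

theorem theorem2p7 (N : ℕ) (hN : 2 ≤ N) (p : ℝ) (hp : 2 < p)
    (hp_sub : 3 ≤ N → p < 2 * (N : ℝ) / ((N : ℝ) - 2))
    (u : ℝ → EuclideanSpace ℝ (Fin N) → ℝ)
    (hu : ∀ᶠ l : ℝ in atTop, IsPositiveRadialSolution N p l (u l)) :
    ((3 ≤ N ∨ (N = 2 ∧ p < 6)) →
      Tendsto (fun l : ℝ => ∫ x in annulus N, u l x ^ 2) atTop atTop) ∧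
    ((N = 2 ∧ p = 6) →
      0 < liminf (fun l : ℝ => ((∫ x in annulus N, u l x ^ 2 : ℝ) : EReal)) atTop ∧
      liminf (fun l : ℝ => ((∫ x in annulus N, u l x ^ 2 : ℝ) : EReal)) atTop < ⊤) ∧
    ((N = 2 ∧ 6 < p) →
      Tendsto (fun l : ℝ => ∫ x in annulus N, u l x ^ 2) atTop (𝓝 0)) := by
  have hN1 : 1 ≤ N := by omega
  have hS := sphereMeasure_real_univ_pos hN1
  refine ⟨fun hcase => ?_, ?_, ?_⟩
  · have hp6 : p < 6 := by
      rcases hcase with h3 | h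
      · have h3' : (3 : ℝ) ≤ N := by exact_mod_cast h3
        -- The critical exponent `2 N / (N - 2)` is at most `6` for `N ≥ 3`, with equality at `N =
        -- 3`.
        refine (hp_sub h3).trans_le ?_
        rw [div_le_iff₀ (by linarith)]
        linarith
      · exact h.2
    have hexp : 0 < (6 - p) / (2 * (p - 2)) := div_pos (by linarith) (by linarith)
    refine tendsto_atTop_mono' atTop ?_
      (((tendsto_rpow_atTop hexp).atTop_div_const zero_lt_two).const_mul_atTop hS)
    filter_upwards [hu, eventually_gt_atTop 0] with l hl hl0
    exact hl.le_integral_sq hN1 hp hp6.le hl0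
  · rintro ⟨rfl, rfl⟩
    constructor
    · have hc : (0 : EReal) < (((sphereMeasure 2).real Set.univ * (1 / 2) : ℝ) : EReal) := by
        exact_mod_cast mul_pos hS one_half_pos
      refine hc.trans_le (le_liminf_of_le (by isBoundedDefault) ?_)
      filter_upwards [hu, eventually_gt_atTop 0] with l hl hl0
      have := hl.le_integral_sq hN1 hp le_rfl hl0
      rw [sub_self, zero_div, Real.rpow_zero] at this
      exact_mod_cast this
    -- At `p = 6` the exponent `3 - p / 2` is zero, so the upper bound is a constant independent of
    -- `l`.
    · refine lt_of_le_of_lt (liminf_le_of_frequently_le' (Eventually.frequently ?_))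
        (EReal.coe_lt_top ((sphereMeasure 2).real Set.univ *
          (2 * (4 * √(6 * 6) + √(6 / 2)))))
      filter_upwards [hu, eventually_gt_atTop 0] with l hl hl0
      have := hl.integral_sq_le le_rfl hl0
      rw [show (3 : ℝ) - 6 / 2 = 0 by norm_num, Real.rpow_zero, mul_one] at this
      exact_mod_cast this
  · rintro ⟨rfl, hp6⟩
    have hlim : Tendsto (fun l : ℝ => (sphereMeasure 2).real Set.univ *
        (2 * ((4 * √(6 * p) + √(p / 2)) * ((l * p / 4) ^ (1 / (p - 2))) ^ (3 - p / 2))))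
        atTop (𝓝 0) := by
      have h1 : Tendsto (fun l : ℝ => l * p / 4) atTop atTop :=
        (tendsto_id.atTop_mul_const (by linarith)).atTop_div_const (by norm_num)
      have h2 := (tendsto_rpow_atTop (y := 1 / (p - 2))
        (one_div_pos.2 (by linarith))).comp h1
      have h3 := (tendsto_rpow_neg_atTop (y := p / 2 - 3) (by linarith)).comp h2
      have h4 := (((h3.const_mul (4 * √(6 * p) + √(p / 2))).const_mul 2).const_mul
        ((sphereMeasure 2).real Set.univ))
      simpa only [mul_zero, neg_sub, Function.comp_def] using h4
    refine tendsto_of_tendsto_of_tendsto_of_le_of_le' tendsto_const_nhds hlim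
      (Eventually.of_forall fun l => integral_nonneg fun x => sq_nonneg _) ?_
    filter_upwards [hu, eventually_gt_atTop 0] with l hl hl0
    exact hl.integral_sq_le hp6.le hl0
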